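/- Let $J,K\ge 0$ be integers, let $P=(p_{jk})\in\mathbb{R}^{J\times K}$ and $Q=(q_{kj})\in\mathbb{R}^{K\times J}$ be stochastic matrices (nonnegative entries, each row summing to $1$), and let $\mu_j>0$ ($1\le j\le J$) and $\eta_k>0$ ($1\le k\le K$). Let $D^m$ be the set of functions $[0,\infty)\to\mathbb{R}^m$ that are right continuous on $[0,\infty)$ and have left limits on $(0,\infty)$, with the Skorokhod $J_1$ topology: $x^n\to x$ iff for every continuity point $T>0$ of $x$, $$\inf_{\lambda}\Big\{\max_{l}\sup_{t\in[0,T]}|x^n_l(\lambda(t))-x_l(t)|\ \vee\ \sup_{t\in[0,T]}|\lambda(t)-t|\Big\}\to 0,$$ the infimum being over increasing homeomorphisms $\lambda$ of $[0,T]$. For $z:[0,\infty)\to\mathbb{R}$ put $\psi(z)(t)=\sup_{s\in[0,t]}\max\{-z(s),0\}$ and $\phi(z)=z+\psi(z)$. For every $(\xi,\zeta)\in D^{J+K}$ there is exactly one $(x,u,y)\in D^{2J+K}$ such that, for all $1\le j\le J$, $1\le k\le K$, $t\ge 0$, with $z_j(t)=\xi_j(t)+\sum_{l=1}^{K}q_{lj}\eta_l\int_0^t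 y_l(s)\,ds$, $$y_k(t)=\zeta_k(t)-\eta_k\int_0^t y_k(s)\,ds-\sum_{j=1}^{J}p_{jk}\,\psi(z_j)(t),\qquad x_j=\phi(z_j),\qquad u_j=\mu_j^{-1}\psi(z_j).$$ Let $f=(f_1,f_2,f_3):D^{J+K}\to D^{2J+K}$ be the nonlinear regulator map $f(\xi,\zeta)=(x,u,y)$ so defined. If moreover $\sum_j\xi_j(t)+\sum_k\zeta_k(t)=0$ for all $t\ge0$ and $\xi_j(0)\ge 0$ for all $j$, then $f(\xi,\zeta)$ is the unique $(x,u,y)\in D^{2J+K}$ satisfying, for all $j,k$ and $t\ge 0$, $$x_j(t)=\xi_j(t)+\sum_{k=1}^{K}q_{kj}\eta_k\int_0^t y_k(s)\,ds+\mu_ju_j(t)\ge 0,$$ $$y_k(t)=\zeta_k(t)-\eta_k\int_0^t y_k(s)\,ds-\sum_{j=1}^{J}p_{jk}\mu_ju_j(t),$$ $$\sum_{j}x_j(t)+\sum_k y_k(t)=0,\qquad u_j\text{ nondecreasing},\ u_j(0)=0,\qquad \int_0^\infty \mathbf{1}_{\{x_j(t)>0\}}\,du_j(t)=0.$$ The map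 $f:D^{J+K}\to D^{2J+K}$ is continuous when both the domain and the range are endowed with the Skorokhod $J_1$ topology; in particular, $(\xi^n,\zeta^n)\to(\xi,\zeta)$ implies $f(\xi^n,\zeta^n)\to f(\xi,\zeta)$. -/

import Mathlib

open Set Filter Topology MeasureTheory
open scoped NNReal ENNReal

noncomputable section

/-! ### The space `D` of càdlàg paths and the Skorokhod `J₁` topology -/

/-- The space `D([0,∞), ℝ^ι)` of functions that are right continuous on `[0,∞)` and have (finite)
left limits on `(0,∞)`. For `D^k` the index set `ι` is any finite set with `k` elements. -/
@[ext]
structure SkorokhodD (ι : Type*) where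
  /-- the path -/
  toFun : ℝ≥0 → ι → ℝ
  right_cts : ∀ t, ContinuousWithinAt toFun (Ici t) t
  left_lim : ∀ t, 0 < t → ∃ l : ι → ℝ, Tendsto toFun (𝓝[<] t) (𝓝 l)

instance {ι : Type*} : CoeFun (SkorokhodD ι) (fun _ => ℝ≥0 → ι → ℝ) := ⟨SkorokhodD.toFun⟩

/-- The zero path. -/
instance {ι : Type*} : Inhabited (SkorokhodD ι) :=
  ⟨⟨fun _ _ => 0, fun _ => continuousWithinAt_const, fun _ _ => ⟨_, tendsto_const_nhds⟩⟩⟩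

/-- `Λ_T`: the increasing homeomorphisms of `[0,T]` onto itself. -/
abbrev TimeChange (T : ℝ≥0) : Type :=
  {l : Icc (0 : ℝ≥0) T ≃ₜ Icc (0 : ℝ≥0) T // StrictMono l}

/-- `d_T(x, y) = inf_{λ ∈ Λ_T} (‖x ∘ λ - y‖_T ∨ ‖λ - e‖_T)` for the restrictions of `x`, `y` to
`[0,T]`, where `‖·‖_T` is the maximum over the components of the supremum over `[0,T]`
(`edist` on `ι → ℝ` is the maximum of the coordinate distances). The value is finite for càdlàg
paths. -/
def skorokhodDist {ι : Type*} [Fintype ι] (T : ℝ≥0) (x y : SkorokhodD ι) : ℝ≥0∞ :=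
  ⨅ l : TimeChange T,
    max (⨆ t : Icc (0 : ℝ≥0) T, edist (x (l.1 t)) (y t))
      (⨆ t : Icc (0 : ℝ≥0) T, edist (l.1 t) t)

/-- Convergence `xⁿ → x` in the Skorokhod `J₁` sense: `d_T(xⁿ, x) → 0` for every continuity point
`T > 0` of `x`. -/
def J1Converges {ι : Type*} [Fintype ι] (u : ℕ → SkorokhodD ι) (x : SkorokhodD ι) : Prop :=
  ∀ T : ℝ≥0, 0 < T → ContinuousAt x T →
    Tendsto (fun n => skorokhodDist T (u n) x) atTop (𝓝 0)

/-- The Skorokhod `J₁` topology. It is metrizable, hence sequential, so it is determined by its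
convergent sequences: `U` is open iff every sequence that `J₁`-converges to a point of `U` is
eventually in `U`. -/
instance {ι : Type*} [Fintype ι] : TopologicalSpace (SkorokhodD ι) where
  IsOpen U := ∀ x ∈ U, ∀ u : ℕ → SkorokhodD ι, J1Converges u x → ∀ᶠ n in atTop, u n ∈ U
  isOpen_univ := fun _ _ _ _ => Eventually.of_forall fun _ => mem_univ _
  isOpen_inter := fun _ _ hU hV x hx u hu => (hU x hx.1 u hu).and (hV x hx.2 u hu)
  isOpen_sUnion := fun S hS x hx u hu => by
    obtain ⟨U, hU, hxU⟩ := hx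
    exact (hS U hU x hxU u hu).mono fun n hn => ⟨U, hU, hn⟩

/-! ### The one-sided reflection map -/

/-- `ψ(z)(t) = sup_{s ∈ [0,t]} [-z(s)]⁺`. -/
def reflPsi (z : ℝ≥0 → ℝ) (t : ℝ≥0) : ℝ := ⨆ s : Icc (0 : ℝ≥0) t, max (-(z s)) 0

/-- `φ(z) = z + ψ(z)`. -/
def reflPhi (z : ℝ≥0 → ℝ) (t : ℝ≥0) : ℝ := z t + reflPsi z t

/-! ### The network parameters, the system of equations and the regulator map -/

/-- Parameters of a closed network with `J` single-server and `K` infinite-server stations: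
stochastic routing matrices `P` (`J × K`) and `Q` (`K × J`), and positive service rates. -/
structure NetworkParams (J K : ℕ) where
  /-- routing matrix from single-server to infinite-server stations -/
  p : Matrix (Fin J) (Fin K) ℝ
  /-- routing matrix from infinite-server to single-server stations -/
  q : Matrix (Fin K) (Fin J) ℝ
  /-- service rates of the single-server stations -/
  μ : Fin J → ℝ
  /-- service rates of the infinite-server stations -/
  η : Fin K → ℝ
  p_nonneg : ∀ j k, 0 ≤ p j k
  p_sum : ∀ j, ∑ k, p j k = 1
  q_nonneg : ∀ k j, 0 ≤ q k j
  q_sum : ∀ k, ∑ j, q k j = 1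
  μ_pos : ∀ j, 0 < μ j
  η_pos : ∀ k, 0 < η k

/-- Inputs `(ξ, ζ) ∈ D^{J+K}`. -/
abbrev InputPath (J K : ℕ) : Type := SkorokhodD (Fin J ⊕ Fin K)

/-- Outputs `(x, u, y) ∈ D^{2J+K}`. -/
abbrev OutputPath (J K : ℕ) : Type := SkorokhodD (Fin J ⊕ Fin J ⊕ Fin K)

namespace InputPath

variable {J K : ℕ}

/-- The component `ξ_j`. -/
def xi (w : InputPath J K) (j : Fin J) (t : ℝ≥0) : ℝ := w t (Sum.inl j)

/-- The component `ζ_k`. -/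
def zeta (w : InputPath J K) (k : Fin K) (t : ℝ≥0) : ℝ := w t (Sum.inr k)

/-- The standing conditions on the data of the system: the components sum to zero at all times and
`ξ_j(0) ≥ 0`. -/
def Admissible (w : InputPath J K) : Prop :=
  (∀ t, ∑ j, w.xi j t + ∑ k, w.zeta k t = 0) ∧ ∀ j, 0 ≤ w.xi j 0

end InputPath

namespace OutputPath

variable {J K : ℕ}

/-- The component `x_j`. -/
def x (v : OutputPath J K) (j : Fin J) (t : ℝ≥0) : ℝ := v t (Sum.inl j)

/-- The component `u_j`. -/
def u (v : OutputPath J K) (j : Fin J) (t : ℝ≥0) : ℝ := v t (Sum.inr (Sum.inl j))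

/-- The component `y_k`. -/
def y (v : OutputPath J K) (k : Fin K) (t : ℝ≥0) : ℝ := v t (Sum.inr (Sum.inr k))

/-- A nondecreasing component `u_j`, as a Stieltjes function on `[0,∞)`. Its measure `du_j` has no
atom at `0`, in accordance with `u_j(0) = 0`. -/
def uStieltjes (v : OutputPath J K) (j : Fin J) (h : Monotone (v.u j)) :
    StieltjesFunction ℝ≥0 where
  toFun := v.u j
  mono' := h
  right_continuous' t :=
    (continuous_apply (Sum.inr (Sum.inl j))).continuousAt.comp_continuousWithinAt (v.right_cts t)

end OutputPath

namespace NetworkParams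

variable {J K : ℕ}

/-- The net input `z_j(t) = ξ_j(t) + ∑_k q_{kj} η_k ∫_0^t y_k(s) ds` of station `j`. -/
def netInput (N : NetworkParams J K) (w : InputPath J K) (v : OutputPath J K) (j : Fin J)
    (t : ℝ≥0) : ℝ :=
  w.xi j t + ∑ k, N.q k j * N.η k * ∫ s in (0 : ℝ)..t, v.y k s.toNNReal

/-- `v = (x, u, y)` solves the regulator system with data `w = (ξ, ζ)`. -/
structure SolvesSystem (N : NetworkParams J K) (w : InputPath J K) (v : OutputPath J K) :
    Prop where
  x_eq : ∀ j t, v.x j t = w.xi j t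
    + ∑ k, N.q k j * N.η k * (∫ s in (0 : ℝ)..t, v.y k s.toNNReal) + N.μ j * v.u j t
  x_nonneg : ∀ j t, 0 ≤ v.x j t
  y_eq : ∀ k t, v.y k t = w.zeta k t
    - N.η k * (∫ s in (0 : ℝ)..t, v.y k s.toNNReal) - ∑ j, N.p j k * N.μ j * v.u j t
  sum_eq : ∀ t, ∑ j, v.x j t + ∑ k, v.y k t = 0
  u_zero : ∀ j, v.u j 0 = 0
  u_mono : ∀ j, Monotone (v.u j)
  /-- `∫_0^∞ 1_{x_j(t) > 0} du_j(t) = 0` -/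
  complementarity : ∀ j, (v.uStieltjes j (u_mono j)).measure {t | 0 < v.x j t} = 0

/-- `v = (x, u, y)` is given by the explicit formulas for the regulator map at `w = (ξ, ζ)`, which
make sense for every `w`: `y` solves the fixed point equation, and `x_j = φ(z_j)`,
`u_j = μ_j⁻¹ ψ(z_j)`, where `z_j` is the net input. -/
structure IsRegulated (N : NetworkParams J K) (w : InputPath J K) (v : OutputPath J K) :
    Prop where
  x_eq : ∀ j t, v.x j t = reflPhi (N.netInput w v j) t
  u_eq : ∀ j t, v.u j t = (N.μ j)⁻¹ * reflPsi (N.netInput w v j) t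
  y_eq : ∀ k t, v.y k t = w.zeta k t - N.η k * (∫ s in (0 : ℝ)..t, v.y k s.toNNReal)
    - ∑ j, N.p j k * reflPsi (N.netInput w v j) t

/-- The nonlinear regulator map `f = (f₁, f₂, f₃) : D^{J+K} → D^{2J+K}`: the `(x, u, y)` with
`IsRegulated`. (Existence and uniqueness are part of the theorem; without existence the value
would be arbitrary.) -/
def regulatorMap (N : NetworkParams J K) (w : InputPath J K) : OutputPath J K :=
  Classical.epsilon (N.IsRegulated w)

end NetworkParams

end

/-!
The unknown `y` enters the right-hand side of its equation only through the primitives `∫ y_k`, and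
the one-sided reflection `ψ` is Lipschitz for the supremum norm on `[0,t]`. The equation is
therefore of Volterra type: Picard iteration converges locally uniformly (`exists_picard_eq`), and
Grönwall's inequality gives uniqueness (`eq_of_picard_eq`). On admissible data the explicit
formulas agree with the complementarity system because `ψ(z)` is the unique regulator of the
one-sided Skorokhod problem (`measure_reflected_pos_eq_zero`, `eq_reflPsi_of_complementarity`) and
because the routing matrices are stochastic (`IsRegulated.sum_eq`).

For `J₁`-continuity, let `λ_n` be time changes of `[0,T]` that nearly attain the distance of the
inputs. The reflection commutes with time changes, so `y_n ∘ λ_n - y` at `t` is bounded by the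
distance of the inputs plus `∫_0^{λ_n(t)} ‖y_n - y‖`; the time change acts on the primitive of the
fixed path `y` only, which is Lipschitz on `[0,T]` (`close_timeChange`). Reading this bound at
`s = λ_n(t)` and exchanging `y(λ_n⁻¹(s))` for `y(s)` gives an integral inequality for `‖y_n - y‖` in
the original time scale, with the additional term `∫_0^T ‖y(λ_n⁻¹(s)) - y(s)‖ ds`
(`IsRegulated.gap_le`). That term tends to `0` by dominated convergence, since a càdlàg path has
only countably many discontinuities (`tendsto_prim_shift`). Hence `∫_0^T ‖y_n - y‖ → 0`, and the
same time changes `λ_n` serve for the outputs (`IsRegulated.dist_le`). Finally, a continuity point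
of the output is a continuity point of the input (`IsRegulated.continuousAt_input`), so the
convergence of the inputs is available at all horizons `T` where it is needed.
-/

noncomputable section

/-! ### Càdlàg paths -/

/-- A path on `[0,∞)` is càdlàg if it is right continuous and has left limits on `(0,∞)`; this is
the predicate bundled in `SkorokhodD`, for paths with values in any space. -/
def IsCadlag {E : Type*} [TopologicalSpace E] (f : ℝ≥0 → E) : Prop :=
  (∀ t, ContinuousWithinAt f (Ici t) t) ∧ ∀ t, 0 < t → ∃ l, Tendsto f (𝓝[<] t) (𝓝 l)

namespace IsCadlag

section Closure

variable {E F : Type*} [TopologicalSpace E] [TopologicalSpace F]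

theorem _root_.Continuous.isCadlag {f : ℝ≥0 → E} (hf : Continuous f) : IsCadlag f :=
  ⟨fun _ => hf.continuousWithinAt, fun t _ => ⟨f t, hf.continuousAt.tendsto.mono_left inf_le_left⟩⟩

theorem _root_.Continuous.comp_isCadlag {g : E → F} (hg : Continuous g) {f : ℝ≥0 → E}
    (hf : IsCadlag f) : IsCadlag fun t => g (f t) :=
  ⟨fun t => hg.continuousAt.comp_continuousWithinAt (hf.1 t), fun t ht =>
    let ⟨l, hl⟩ := hf.2 t ht
    ⟨g l, (hg.tendsto l).comp hl⟩⟩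

theorem pi {ι : Type*} {f : ℝ≥0 → ι → ℝ} (hf : ∀ i, IsCadlag fun t => f t i) : IsCadlag f := by
  refine ⟨fun t => continuousWithinAt_pi.2 fun i => (hf i).1 t, fun t ht => ?_⟩
  choose l hl using fun i => (hf i).2 t ht
  exact ⟨l, tendsto_pi_nhds.2 hl⟩

theorem apply {ι : Type*} {f : ℝ≥0 → ι → ℝ} (hf : IsCadlag f) (i : ι) : IsCadlag fun t => f t i :=
  (continuous_apply i).comp_isCadlag hf

theorem add {f g : ℝ≥0 → ℝ} (hf : IsCadlag f) (hg : IsCadlag g) : IsCadlag fun t => f t + g t :=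
  ⟨fun t => (hf.1 t).add (hg.1 t), fun t ht =>
    let ⟨_, h⟩ := hf.2 t ht
    let ⟨_, h'⟩ := hg.2 t ht
    ⟨_, h.add h'⟩⟩

theorem const_mul {f : ℝ≥0 → ℝ} (c : ℝ) (hf : IsCadlag f) : IsCadlag fun t => c * f t :=
  (continuous_const_mul c).comp_isCadlag hf

theorem sub {f g : ℝ≥0 → ℝ} (hf : IsCadlag f) (hg : IsCadlag g) : IsCadlag fun t => f t - g t := by
  simpa [sub_eq_add_neg] using hf.add (hg.const_mul (-1))

theorem sum {ι : Type*} (s : Finset ι) {f : ι → ℝ≥0 → ℝ} (hf : ∀ i, IsCadlag (f i)) :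
    IsCadlag fun t => ∑ i ∈ s, f i t :=
  ⟨fun t => tendsto_finsetSum _ fun i _ => (hf i).1 t, fun t ht => by
    choose l hl using fun i => (hf i).2 t ht
    exact ⟨_, tendsto_finsetSum s fun i _ => hl i⟩⟩

end Closure

theorem exists_bound {E : Type*} [NormedAddCommGroup E] {f : ℝ≥0 → E} (hf : IsCadlag f)
    (T : ℝ≥0) : ∃ M, 0 ≤ M ∧ ∀ t ≤ T, ‖f t‖ ≤ M := by
  suffices h : ∃ M, ∀ t ∈ Icc 0 T, ‖f t‖ ≤ M by
    obtain ⟨M, hM⟩ := h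
    exact ⟨M, (norm_nonneg _).trans (hM 0 (by simp)), fun t ht => hM t ⟨zero_le, ht⟩⟩
  refine isCompact_Icc.induction_on (p := fun s => ∃ M, ∀ t ∈ s, ‖f t‖ ≤ M) ⟨0, by simp⟩
    (fun s t hst ⟨M, hM⟩ => ⟨M, fun r hr => hM r (hst hr)⟩) ?_ fun t _ => ?_
  · rintro s t ⟨M, hM⟩ ⟨M', hM'⟩
    exact ⟨max M M', fun r hr => hr.elim (fun h => (hM r h).trans (le_max_left _ _))
      fun h => (hM' r h).trans (le_max_right _ _)⟩
  · suffices h : ∃ M, ∀ᶠ r in 𝓝 t, ‖f r‖ ≤ M by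
      obtain ⟨M, hM⟩ := h
      exact ⟨_, mem_nhdsWithin_of_mem_nhds hM, M, fun r hr => hr⟩
    have hR : ∀ᶠ r in 𝓝[≥] t, ‖f r‖ < ‖f t‖ + 1 :=
      (hf.1 t).norm.eventually_lt_const (lt_add_one _)
    have hL : ∃ M, ∀ᶠ r in 𝓝[<] t, ‖f r‖ < M := by
      rcases eq_zero_or_pos t with rfl | ht
      · exact ⟨0, by simp [nhdsWithin]⟩
      · obtain ⟨l, hl⟩ := hf.2 t ht
        exact ⟨_, hl.norm.eventually_lt_const (lt_add_one _)⟩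
    obtain ⟨M, hL⟩ := hL
    refine ⟨max M (‖f t‖ + 1), ?_⟩
    rw [← nhdsLT_sup_nhdsGE, eventually_sup]
    exact ⟨hL.mono fun r h => h.le.trans (le_max_left _ _),
      hR.mono fun r h => h.le.trans (le_max_right _ _)⟩

/-- A right continuous path is the pointwise limit of its samples at the next point of the grid
`{k / (n + 1)}` strictly to the right. -/
theorem measurable {E : Type*} [TopologicalSpace E]
    [TopologicalSpace.PseudoMetrizableSpace E] [MeasurableSpace E] [BorelSpace E]
    {f : ℝ≥0 → E} (hf : IsCadlag f) : Measurable f := by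
  let a : ℕ → ℝ≥0 → ℝ≥0 := fun n t => (⌊(n + 1 : ℝ≥0) * t⌋₊ + 1 : ℝ≥0) / (n + 1)
  have hpos : ∀ n : ℕ, (0 : ℝ≥0) < n + 1 := fun n => by positivity
  have h1 : ∀ n t, t ≤ a n t := fun n t => by
    rw [le_div_iff₀ (hpos n), mul_comm]
    exact (Nat.lt_floor_add_one _).le
  have h2 : ∀ n t, a n t ≤ t + 1 / (n + 1) := fun n t => by
    rw [div_le_iff₀ (hpos n), add_mul t, div_mul_cancel₀ _ (hpos n).ne', mul_comm t]
    gcongr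
    exact Nat.floor_le zero_le
  refine measurable_of_tendsto_metrizable (f := fun n t => f (a n t)) (fun n => ?_)
    (tendsto_pi_nhds.2 fun t => ?_)
  · have : Measurable fun t : ℝ≥0 => ⌊(n + 1 : ℝ≥0) * t⌋₊ :=
      Nat.measurable_floor.comp (measurable_const_mul _)
    exact (measurable_from_nat (f := fun k : ℕ => f ((k + 1 : ℝ≥0) / (n + 1)))).comp this
  · refine (hf.1 t).tendsto.comp (tendsto_nhdsWithin_iff.2 ⟨?_, .of_forall fun n => h1 n t⟩)
    refine tendsto_of_tendsto_of_tendsto_of_le_of_le tendsto_const_nhds ?_ (fun n => h1 n t)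
      fun n => h2 n t
    simpa using (tendsto_const_nhds (x := t)).add
      (tendsto_one_div_add_atTop_nhds_zero_nat (𝕜 := ℝ≥0))

/-- The points at which the oscillation is at least `1 / (n + 1)` are isolated, because the path
has one-sided limits everywhere. -/
theorem countable_not_continuousAt {E : Type*} [PseudoMetricSpace E] {f : ℝ≥0 → E}
    (hf : IsCadlag f) : {t | ¬ ContinuousAt f t}.Countable := by
  let D : ℕ → Set ℝ≥0 := fun n =>
    {t | ¬ ∃ l, ∀ᶠ r in 𝓝 t, dist (f r) l < 1 / (n + 1 : ℝ)}
  have key : ∀ n t, ∀ᶠ r in 𝓝[≠] t, r ∉ D n := by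
    intro n t
    have aux : ∀ (s : Set ℝ≥0) (l : E), IsOpen s → Tendsto f (𝓝[s] t) (𝓝 l) →
        ∀ᶠ r in 𝓝[s] t, r ∉ D n := by
      intro s l hs hl
      have h1 : ∀ᶠ r in 𝓝[s] t, dist (f r) l < 1 / (n + 1 : ℝ) :=
        hl.eventually (Metric.ball_mem_nhds l (by positivity))
      filter_upwards [eventually_eventually_nhdsWithin.2 h1, self_mem_nhdsWithin] with r hr hrs
      rw [hs.nhdsWithin_eq hrs] at hr
      exact fun h => h ⟨l, hr⟩
    rw [← Iio_union_Ioi, nhdsWithin_union, eventually_sup]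
    refine ⟨?_, aux _ (f t) isOpen_Ioi ((hf.1 t).mono_left (nhdsWithin_mono _ Ioi_subset_Ici_self))⟩
    rcases eq_zero_or_pos t with rfl | ht
    · simp [nhdsWithin]
    · obtain ⟨l, hl⟩ := hf.2 t ht
      exact aux _ l isOpen_Iio hl
  have hD : ∀ n, (D n).Countable := by
    intro n
    obtain ⟨c, hcD, hc, hcov⟩ := TopologicalSpace.countable_cover_nhdsWithin
      (s := D n) (f := fun x => {x}) fun x _ => by
        have := eventually_nhdsWithin_iff.1 (key n x)
        refine mem_nhdsWithin_iff_eventually.2 (this.mono fun r hr hrD => ?_)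
        by_contra h
        exact hr h hrD
    exact hc.mono fun x hx => by simpa using hcov hx
  refine (countable_iUnion hD).mono fun t ht => ?_
  by_contra hn
  simp only [mem_iUnion, not_exists] at hn
  refine ht (Metric.tendsto_nhds.2 fun ε hε => ?_)
  obtain ⟨n, hn'⟩ := exists_nat_one_div_lt (half_pos hε)
  obtain ⟨l, hl⟩ := not_not.1 (hn n)
  filter_upwards [hl] with r hr
  have := hl.self_of_nhds
  have := dist_triangle_right (f r) (f t) l
  linarith

theorem ae_continuousAt {E : Type*} [PseudoMetricSpace E] {f : ℝ≥0 → E} (hf : IsCadlag f) :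
    ∀ᵐ s : ℝ, 0 ≤ s → ContinuousAt f s.toNNReal := by
  refine measure_mono_null (fun s hs => ?_)
    ((hf.countable_not_continuousAt.image ((↑) : ℝ≥0 → ℝ)).measure_zero volume)
  simp only [mem_compl_iff, mem_ofPred_eq, Classical.not_imp] at hs
  exact ⟨s.toNNReal, hs.2, Real.coe_toNNReal s hs.1⟩

end IsCadlag

theorem SkorokhodD.isCadlag {ι : Type*} (x : SkorokhodD ι) : IsCadlag x.toFun :=
  ⟨x.right_cts, x.left_lim⟩

/-! ### The one-sided reflection -/

section Reflection

variable {z z' : ℝ≥0 → ℝ} {t t' : ℝ≥0}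

theorem IsCadlag.exists_neg_le (hz : IsCadlag z) (t : ℝ≥0) : ∃ M, ∀ s ≤ t, -z s ≤ M :=
  let ⟨M, _, hM⟩ := hz.exists_bound t
  ⟨M, fun s hs => (neg_le_abs _).trans (hM s hs)⟩

theorem reflPsi_nonneg (z : ℝ≥0 → ℝ) (t : ℝ≥0) : 0 ≤ reflPsi z t :=
  Real.iSup_nonneg fun _ => le_max_right _ _

theorem reflPsi_le {c : ℝ} (hc : 0 ≤ c) (h : ∀ s ≤ t, -z s ≤ c) : reflPsi z t ≤ c :=
  have : Nonempty (Icc (0 : ℝ≥0) t) := ⟨⟨0, by simp⟩⟩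
  ciSup_le fun s => max_le (h s s.2.2) hc

/-- The bound `hz` rules out the junk value of an unbounded supremum. -/
theorem neg_le_reflPsi (hz : ∃ M, ∀ s ≤ t, -z s ≤ M) {s : ℝ≥0} (hs : s ≤ t) :
    -z s ≤ reflPsi z t := by
  obtain ⟨M, hM⟩ := hz
  have hbdd : BddAbove (range fun s : Icc (0 : ℝ≥0) t => max (-(z s)) 0) := by
    refine ⟨max M 0, ?_⟩
    rintro _ ⟨s, rfl⟩
    exact max_le_max_right _ (hM s s.2.2)
  exact (le_max_left _ _).trans (le_ciSup hbdd ⟨s, zero_le, hs⟩)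

/-- Comparison of running suprema of two paths at two times: every value of `-z` on `[0,t]` only
has to be dominated, up to `ε`, by some value of `-z'` on `[0,t']`. This form covers both a change
of the path and a change of time. -/
theorem reflPsi_le_add {ε : ℝ} (hε : 0 ≤ ε) (hz' : ∃ M, ∀ s ≤ t', -z' s ≤ M)
    (h : ∀ s ≤ t, ∃ s' ≤ t', -z s ≤ -z' s' + ε) : reflPsi z t ≤ reflPsi z' t' + ε :=
  reflPsi_le (add_nonneg (reflPsi_nonneg _ _) hε) fun s hs =>
    let ⟨_, hs', h'⟩ := h s hs
    h'.trans (add_le_add_left (neg_le_reflPsi hz' hs') _)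

theorem IsCadlag.reflPsi_mono (hz : IsCadlag z) : Monotone (reflPsi z) := fun _ t hst =>
  reflPsi_le (reflPsi_nonneg _ _) fun _ hr => neg_le_reflPsi (hz.exists_neg_le t) (hr.trans hst)

theorem IsCadlag.reflPsi (hz : IsCadlag z) : IsCadlag (reflPsi z) := by
  refine ⟨fun t => ?_, fun t _ => ⟨_, hz.reflPsi_mono.tendsto_nhdsLT t⟩⟩
  refine Metric.tendsto_nhds.2 fun ε hε => ?_
  have h1 : ∀ᶠ r in 𝓝[≥] t, dist (z r) (z t) < ε / 2 :=
    (hz.1 t).eventually (Metric.ball_mem_nhds _ (half_pos hε))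
  obtain ⟨u, hu, h1⟩ := (mem_nhdsGE_iff_exists_Ico_subset).1 h1
  filter_upwards [Ico_mem_nhdsGE hu] with s hs
  have h2 : _root_.reflPsi z s ≤ _root_.reflPsi z t + ε / 2 := by
    refine reflPsi_le_add (half_pos hε).le (hz.exists_neg_le t) fun r hr => ?_
    rcases le_total r t with hrt | hrt
    · exact ⟨r, hrt, by linarith⟩
    · have := h1 ⟨hrt, hr.trans_lt hs.2⟩
      rw [mem_ofPred_eq, Real.dist_eq, abs_lt] at this
      exact ⟨t, le_rfl, by linarith⟩
  have h3 := hz.reflPsi_mono hs.1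
  rw [Real.dist_eq, abs_lt]
  constructor <;> linarith

/-- A set is null if each of its points `t` is the left end point of a null interval `[t,r)`: group
the points by a rational number in `(t,r)`; inside a group, each point but possibly the least one
is interior to a null interval. -/
theorem measure_null_of_forall_exists_Ico {μ : Measure ℝ≥0} {S : Set ℝ≥0}
    (h : ∀ t ∈ S, ∃ r, t < r ∧ μ (Ico t r) = 0) : μ S = 0 := by
  obtain ⟨c, hc, hdense⟩ := TopologicalSpace.exists_countable_dense ℝ≥0
  let A : ℝ≥0 → Set ℝ≥0 := fun r => {t | t < r ∧ μ (Ico t r) = 0}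
  have hA : ∀ r, μ (A r) = 0 := by
    intro r
    refine measure_null_of_locally_null _ fun t ht => ?_
    by_cases hmin : ∃ t' ∈ A r, t' < t
    · obtain ⟨t', ht', hlt⟩ := hmin
      exact ⟨Ico t' r, mem_nhdsWithin_of_mem_nhds (Ico_mem_nhds hlt ht.1), ht'.2⟩
    · refine ⟨Ico t r, mem_of_superset self_mem_nhdsWithin fun s hs => ⟨?_, hs.1⟩, ht.2⟩
      exact not_lt.1 fun hst => hmin ⟨s, hs, hst⟩
  refine measure_mono_null (fun t ht => ?_) ((measure_biUnion_null_iff hc).2 fun r _ => hA r)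
  obtain ⟨r, htr, hr⟩ := h t ht
  obtain ⟨q, hq, htq, hqr⟩ := hdense.exists_between htr
  exact mem_biUnion hq ⟨htq, measure_mono_null (Ico_subset_Ico_right hqr.le) hr⟩

/-- The regulator of the one-sided reflection grows only while the reflected path is at `0`. -/
theorem measure_reflected_pos_eq_zero (f : StieltjesFunction ℝ≥0) {c : ℝ} (hc : 0 < c)
    (hz : IsCadlag z) (hf : ∀ t, c * f t = reflPsi z t) :
    f.measure {t | 0 < z t + reflPsi z t} = 0 := by
  refine measure_null_of_forall_exists_Ico fun t ht => ?_
  replace ht : -z t < reflPsi z t := by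
    have : 0 < z t + reflPsi z t := ht
    linarith
  have h1 : ∀ᶠ r in 𝓝[≥] t, -z r < reflPsi z t := (hz.1 t).neg.eventually_lt_const ht
  obtain ⟨u, hu, h1⟩ := (mem_nhdsGE_iff_exists_Ico_subset).1 h1
  obtain ⟨r, htr, hru⟩ := exists_between (mem_Ioi.1 hu)
  have h2 : f r ≤ f t := by
    rw [← mul_le_mul_iff_right₀ hc, hf, hf]
    refine reflPsi_le (reflPsi_nonneg _ _) fun s hs => ?_
    rcases le_total s t with hst | hst
    · exact neg_le_reflPsi (hz.exists_neg_le t) hst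
    · exact (h1 ⟨hst, hs.trans_lt hru⟩).le
  -- there is no jump at `t`, since a jump of the running supremum would put `z + ψ(z)` at `0`
  have h3 : f t ≤ Function.leftLim f t := by
    rcases eq_zero_or_pos t with rfl | ht0
    · exact (leftLim_eq_of_isBot fun s => zero_le).ge
    · by_contra! hlt
      have h0 : 0 ≤ c * Function.leftLim f t :=
        (reflPsi_nonneg z 0).trans
          ((hf 0).symm.le.trans (mul_le_mul_of_nonneg_left (f.mono.le_leftLim ht0) hc.le))
      have h4 : reflPsi z t ≤ max (c * Function.leftLim f t) (-z t) := by
        refine reflPsi_le (h0.trans (le_max_left _ _)) fun s hs => ?_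
        rcases hs.eq_or_lt with rfl | hs
        · exact le_max_right _ _
        · refine le_max_of_le_left ((neg_le_reflPsi (hz.exists_neg_le s) le_rfl).trans ?_)
          rw [← hf]
          exact mul_le_mul_of_nonneg_left (f.mono.le_leftLim hs) hc.le
      rcases le_max_iff.1 h4 with h | h
      · rw [← hf] at h
        exact absurd (le_of_mul_le_mul_left h hc) (not_le.2 hlt)
      · exact absurd h (not_le.2 ht)
  refine ⟨r, htr, measure_mono_null Ico_subset_Icc_self ?_⟩
  rw [StieltjesFunction.measure_Icc, ENNReal.ofReal_eq_zero]
  linarith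

/-- Uniqueness in the one-sided Skorokhod problem. -/
theorem eq_reflPsi_of_complementarity (f : StieltjesFunction ℝ≥0) {c : ℝ} (hc : 0 < c)
    (h0 : f 0 = 0) (hnn : ∀ t, 0 ≤ z t + c * f t)
    (hcompl : f.measure {t | 0 < z t + c * f t} = 0) (t : ℝ≥0) : c * f t = reflPsi z t := by
  have hf : ∀ t, 0 ≤ f t := fun t => h0 ▸ f.mono zero_le
  have hle : ∀ s ≤ t, -z s ≤ c * f t := fun s hs => by
    have := hnn s
    have := mul_le_mul_of_nonneg_left (f.mono hs) hc.le
    linarith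
  refine le_antisymm ?_ (reflPsi_le (mul_nonneg hc.le (hf t)) hle)
  by_contra! hlt
  -- the times up to `t` at which `c * f` exceeds `ψ(z)(t)` form an interval of positive reflected
  -- path, over which `f` would have to increase
  set A : Set ℝ≥0 := {s | s ≤ t ∧ reflPsi z t < c * f s}
  have htA : t ∈ A := ⟨le_rfl, hlt⟩
  have hAnull : f.measure A = 0 := measure_mono_null (fun s hs => by
    have := neg_le_reflPsi ⟨_, hle⟩ hs.1
    have := hs.2
    show 0 < z s + c * f s
    linarith) hcompl
  have hAup : ∀ s ∈ A, ∀ r, s ≤ r → r ≤ t → r ∈ A := fun s hs r hsr hrt =>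
    ⟨hrt, hs.2.trans_le (mul_le_mul_of_nonneg_left (f.mono hsr) hc.le)⟩
  set τ := sInf A
  have hτt : τ ≤ t := csInf_le' htA
  have hIoc : Ioc τ t ⊆ A := fun r hr =>
    let ⟨s, hs, hsr⟩ := exists_lt_of_csInf_lt ⟨t, htA⟩ hr.1
    hAup s hs r hsr.le hr.2
  have hτ : f t ≤ f τ := by
    have := measure_mono_null hIoc hAnull
    rw [StieltjesFunction.measure_Ioc, ENNReal.ofReal_eq_zero] at this
    linarith
  have hτA : τ ∈ A := ⟨hτt, hlt.trans_le (mul_le_mul_of_nonneg_left hτ hc.le)⟩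
  have hτ0 : 0 < τ := by
    refine pos_iff_ne_zero.2 fun h => ?_
    have := hτA.2
    rw [h, h0, mul_zero] at this
    exact absurd this (not_lt.2 (reflPsi_nonneg _ _))
  have hsing := measure_mono_null (singleton_subset_iff.2 hτA) hAnull
  rw [StieltjesFunction.measure_singleton, ENNReal.ofReal_eq_zero] at hsing
  have : (𝓝[<] τ).NeBot := nhdsLT_neBot_of_exists_lt ⟨0, hτ0⟩
  have hlim : Function.leftLim f τ ≤ reflPsi z t / c := by
    refine le_of_tendsto (f.mono.tendsto_leftLim τ) ?_
    filter_upwards [self_mem_nhdsWithin] with s hs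
    rw [le_div_iff₀ hc, mul_comm]
    by_contra! h
    have hsA : s ∈ A := ⟨(mem_Iio.1 hs).le.trans hτt, h⟩
    exact absurd (csInf_le' hsA) (not_le.2 hs)
  rw [le_div_iff₀ hc, mul_comm] at hlim
  have h1 := hτA.2
  have h2 := mul_le_mul_of_nonneg_left (sub_nonpos.1 hsing) hc.le
  linarith

end Reflection

/-! ### Primitives and Grönwall's inequality -/

section Primitive

/-- Measurable paths that are bounded on bounded time intervals. -/
def IsLocBdd {E : Type*} [NormedAddCommGroup E] [MeasurableSpace E] (y : ℝ≥0 → E) : Prop :=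
  Measurable y ∧ ∀ T, ∃ M, 0 ≤ M ∧ ∀ t ≤ T, ‖y t‖ ≤ M

/-- The primitive `t ↦ ∫_0^t y(s) ds` of a path on `[0,∞)`. -/
def prim (y : ℝ≥0 → ℝ) (t : ℝ≥0) : ℝ := ∫ s in (0 : ℝ)..t, y s.toNNReal

section

variable {E : Type*} [NormedAddCommGroup E] [MeasurableSpace E] [BorelSpace E] {y y' : ℝ≥0 → E}

theorem IsCadlag.isLocBdd (hy : IsCadlag y) : IsLocBdd y := ⟨hy.measurable, hy.exists_bound⟩

theorem IsLocBdd.norm (hy : IsLocBdd y) : IsLocBdd fun t => ‖y t‖ :=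
  ⟨hy.1.norm, fun T => let ⟨M, h0, hM⟩ := hy.2 T; ⟨M, h0, fun t ht => by simpa using hM t ht⟩⟩

theorem IsLocBdd.add [SecondCountableTopology E] (hy : IsLocBdd y) (hy' : IsLocBdd y') :
    IsLocBdd fun t => y t + y' t := by
  refine ⟨hy.1.add hy'.1, fun T => ?_⟩
  obtain ⟨M, h0, hM⟩ := hy.2 T
  obtain ⟨M', h0', hM'⟩ := hy'.2 T
  exact ⟨M + M', by positivity, fun t ht =>
    (norm_add_le _ _).trans (add_le_add (hM t ht) (hM' t ht))⟩

theorem IsLocBdd.sub [SecondCountableTopology E] (hy : IsLocBdd y) (hy' : IsLocBdd y') :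
    IsLocBdd fun t => y t - y' t := by
  refine ⟨hy.1.sub hy'.1, fun T => ?_⟩
  obtain ⟨M, h0, hM⟩ := hy.2 T
  obtain ⟨M', h0', hM'⟩ := hy'.2 T
  exact ⟨M + M', by positivity, fun t ht =>
    (norm_sub_le _ _).trans (add_le_add (hM t ht) (hM' t ht))⟩

end

theorem IsLocBdd.apply {ι : Type*} [Fintype ι] {y : ℝ≥0 → ι → ℝ} (hy : IsLocBdd y) (i : ι) :
    IsLocBdd fun t => y t i :=
  ⟨(measurable_pi_apply i).comp hy.1, fun T => let ⟨M, h0, hM⟩ := hy.2 T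
    ⟨M, h0, fun t ht => (norm_le_pi_norm _ i).trans (hM t ht)⟩⟩

variable {y y' : ℝ≥0 → ℝ}

theorem IsLocBdd.intervalIntegrable (hy : IsLocBdd y) (a b : ℝ) :
    IntervalIntegrable (fun s => y s.toNNReal) volume a b := by
  obtain ⟨M, h0, hM⟩ := hy.2 (max a b).toNNReal
  rw [intervalIntegrable_iff]
  refine Measure.integrableOn_of_bounded (M := M) (by simp)
    (hy.1.comp measurable_real_toNNReal).aestronglyMeasurable ?_
  filter_upwards [ae_restrict_mem measurableSet_uIoc] with s hs
  exact hM _ (Real.toNNReal_le_toNNReal (uIoc_subset_uIcc hs).2)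

theorem IsLocBdd.continuous_prim (hy : IsLocBdd y) : Continuous (prim y) :=
  (intervalIntegral.continuous_primitive hy.intervalIntegrable 0).comp NNReal.continuous_coe

theorem prim_le_prim (hy : IsLocBdd y) (hy' : IsLocBdd y') {t : ℝ≥0} (h : ∀ s ≤ t, y s ≤ y' s) :
    prim y t ≤ prim y' t :=
  intervalIntegral.integral_mono_on t.2 (hy.intervalIntegrable _ _) (hy'.intervalIntegrable _ _)
    fun _ hs => h _ (Real.toNNReal_le_iff_le_coe.2 hs.2)

theorem prim_sub (hy : IsLocBdd y) (hy' : IsLocBdd y') (t : ℝ≥0) :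
    prim (fun s => y s - y' s) t = prim y t - prim y' t :=
  intervalIntegral.integral_sub (hy.intervalIntegrable _ _) (hy'.intervalIntegrable _ _)

theorem prim_add (hy : IsLocBdd y) (hy' : IsLocBdd y') (t : ℝ≥0) :
    prim (fun s => y s + y' s) t = prim y t + prim y' t :=
  intervalIntegral.integral_add (hy.intervalIntegrable _ _) (hy'.intervalIntegrable _ _)

theorem prim_const_mul (c : ℝ) (y : ℝ≥0 → ℝ) (t : ℝ≥0) :
    prim (fun s => c * y s) t = c * prim y t :=
  intervalIntegral.integral_const_mul _ _

theorem prim_const (c : ℝ) (t : ℝ≥0) : prim (fun _ => c) t = t * c := by simp [prim]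

theorem abs_prim_le (y : ℝ≥0 → ℝ) (t : ℝ≥0) : |prim y t| ≤ prim (fun s => |y s|) t :=
  intervalIntegral.abs_integral_le_integral_abs t.2

theorem prim_mono (hy : IsLocBdd y) (h0 : ∀ t, 0 ≤ y t) : Monotone (prim y) := fun s t hst => by
  have := intervalIntegral.integral_add_adjacent_intervals (hy.intervalIntegrable 0 s)
    (hy.intervalIntegrable s t)
  have h : 0 ≤ ∫ r in (s : ℝ)..t, y r.toNNReal :=
    intervalIntegral.integral_nonneg hst fun r _ => h0 _
  simp only [prim]
  linarith

theorem prim_nonneg (h0 : ∀ t, 0 ≤ y t) (t : ℝ≥0) : 0 ≤ prim y t :=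
  intervalIntegral.integral_nonneg t.2 fun _ _ => h0 _

theorem abs_prim_sub_le (hy : IsLocBdd y) {M : ℝ} {T : ℝ≥0} (hM : ∀ t ≤ T, ‖y t‖ ≤ M) {s t : ℝ≥0}
    (hs : s ≤ T) (ht : t ≤ T) : |prim y t - prim y s| ≤ M * dist t s := by
  rw [prim, prim, intervalIntegral.integral_interval_sub_left (hy.intervalIntegrable _ _)
    (hy.intervalIntegrable _ _)]
  refine intervalIntegral.norm_integral_le_of_norm_le_const fun r hr => hM _ ?_
  rw [Real.toNNReal_le_iff_le_coe]
  exact (uIoc_subset_uIcc hr).2.trans (max_le hs ht)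

theorem abs_prim_apply_sub_le {ι : Type*} [Fintype ι] {y y' : ℝ≥0 → ι → ℝ} (hy : IsLocBdd y)
    (hy' : IsLocBdd y') (t : ℝ≥0) (i : ι) :
    |prim (fun s => y s i) t - prim (fun s => y' s i) t| ≤ prim (fun s => ‖y s - y' s‖) t := by
  rw [← prim_sub (hy.apply i) (hy'.apply i)]
  exact (abs_prim_le _ t).trans (prim_le_prim ((hy.apply i).sub (hy'.apply i)).norm
    (hy.sub hy').norm fun s _ => norm_le_pi_norm (y s - y' s) i)

/-- Grönwall's inequality in integrated form, for a discontinuous function `d`: only its primitive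
is estimated. -/
theorem prim_le_of_le_add_mul_prim {d b : ℝ≥0 → ℝ} (hd : IsLocBdd d) (hd0 : ∀ t, 0 ≤ d t)
    (hb : IsLocBdd b) (hb0 : ∀ t, 0 ≤ b t) {C : ℝ} (hC : 0 < C) {T : ℝ≥0}
    (h : ∀ t ≤ T, d t ≤ b t + C * prim d t) : prim d T ≤ prim b T * Real.exp (C * T) := by
  have hG : IsLocBdd (prim d) := (hd.continuous_prim.isCadlag).isLocBdd
  have hint : ∀ t ≤ T, prim d t ≤ prim b T + C * prim (prim d) t := fun t ht => by
    have hCG : IsLocBdd fun s => C * prim d s :=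
      (continuous_const.mul hd.continuous_prim).isCadlag.isLocBdd
    calc prim d t ≤ prim (fun s => b s + C * prim d s) t :=
          prim_le_prim hd (hb.add hCG) fun s hs => h s (hs.trans ht)
      _ = prim b t + C * prim (prim d) t := by rw [prim_add hb hCG, prim_const_mul]
      _ ≤ _ := by gcongr; exact prim_mono hb hb0 ht
  let F : ℝ → ℝ := fun t => ∫ s in (0 : ℝ)..t, prim d s.toNNReal
  have hcont : Continuous fun s : ℝ => prim d s.toNNReal :=
    hd.continuous_prim.comp continuous_real_toNNReal
  have hF' : ∀ t, HasDerivAt F (prim d t.toNNReal) t := fun t =>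
    intervalIntegral.integral_hasDerivAt_right (hcont.intervalIntegrable _ _)
      (hcont.stronglyMeasurableAtFilter _ _) hcont.continuousAt
  have hnn := prim_nonneg hd0
  have hF0 : ∀ t, 0 ≤ t → 0 ≤ F t := fun t ht =>
    intervalIntegral.integral_nonneg ht fun s _ => hnn _
  have hgr := norm_le_gronwallBound_of_norm_deriv_right_le (f := F) (a := 0) (b := T) (δ := 0)
    (K := C) (ε := prim b T) (fun t _ => (hF' t).continuousAt.continuousWithinAt)
    (fun t _ => (hF' t).hasDerivWithinAt) (by simp [F]) (fun t ht => by
      rw [Real.norm_of_nonneg (hnn _), Real.norm_of_nonneg (hF0 t ht.1), add_comm]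
      have := hint t.toNNReal (Real.toNNReal_le_iff_le_coe.2 ht.2.le)
      rw [prim.eq_1 (prim d), Real.coe_toNNReal t ht.1] at this
      exact this) T ⟨T.2, le_rfl⟩
  rw [Real.norm_of_nonneg (hF0 T T.2), gronwallBound_of_K_ne_0 hC.ne', sub_zero] at hgr
  have h1 := hint T le_rfl
  have h2 : prim (prim d) T = F T := rfl
  rw [h2] at h1
  calc prim d T ≤ _ := h1
    _ ≤ prim b T + C * (0 * Real.exp (C * T) + prim b T / C * (Real.exp (C * T) - 1)) := by gcongr
    _ = _ := by field_simp; ring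

end Primitive

/-! ### Lipschitz estimates for the equation of `y` -/

namespace NetworkParams

variable {J K : ℕ} (N : NetworkParams J K)

/-- The net input `ξ_j + ∑_k q_{kj} η_k I_k`, as a function of the primitives `I_k = ∫ y_k`. -/
def netOf (w : InputPath J K) (I : Fin K → ℝ≥0 → ℝ) (j : Fin J) (t : ℝ≥0) : ℝ :=
  w.xi j t + ∑ k, N.q k j * N.η k * I k t

/-- The right-hand side `ζ_k - η_k I_k - ∑_j p_{jk} ψ(z_j)` of the equation for `y`, as a function
of the primitives `I_k = ∫ y_k`. -/
def rhsOf (w : InputPath J K) (I : Fin K → ℝ≥0 → ℝ) (t : ℝ≥0) (k : Fin K) : ℝ :=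
  w.zeta k t - N.η k * I k t - ∑ j, N.p j k * reflPsi (N.netOf w I j) t

/-- A Lipschitz constant of the net inputs. -/
def netLip : ℝ := 1 + ∑ k, N.η k

/-- A Lipschitz constant of the right-hand side of the equation for `y`. -/
def rhsLip : ℝ := N.netLip * (1 + J)

theorem one_le_netLip : 1 ≤ N.netLip :=
  le_add_of_nonneg_right (Finset.sum_nonneg fun k _ => (N.η_pos k).le)

theorem netLip_le_rhsLip : N.netLip ≤ N.rhsLip :=
  le_mul_of_one_le_right (zero_le_one.trans N.one_le_netLip) (by simp)

theorem rhsLip_pos : 0 < N.rhsLip :=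
  zero_lt_one.trans_le (N.one_le_netLip.trans N.netLip_le_rhsLip)

theorem p_le_one (j : Fin J) (k : Fin K) : N.p j k ≤ 1 :=
  N.p_sum j ▸ Finset.single_le_sum (fun k _ => N.p_nonneg j k) (Finset.mem_univ k)

theorem q_le_one (k : Fin K) (j : Fin J) : N.q k j ≤ 1 :=
  N.q_sum k ▸ Finset.single_le_sum (fun j _ => N.q_nonneg k j) (Finset.mem_univ j)

theorem η_le_netLip_sub_one (k : Fin K) : N.η k ≤ N.netLip - 1 := by
  rw [netLip, add_sub_cancel_left]
  exact Finset.single_le_sum (fun k _ => (N.η_pos k).le) (Finset.mem_univ k)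

theorem _root_.InputPath.isCadlag_xi (w : InputPath J K) (j : Fin J) : IsCadlag (w.xi j) :=
  w.isCadlag.apply (Sum.inl j)

theorem _root_.InputPath.isCadlag_zeta (w : InputPath J K) (k : Fin K) : IsCadlag (w.zeta k) :=
  w.isCadlag.apply (Sum.inr k)

variable {N} in
theorem isCadlag_netOf {w : InputPath J K} {I : Fin K → ℝ≥0 → ℝ} (hI : ∀ k, Continuous (I k))
    (j : Fin J) : IsCadlag (N.netOf w I j) :=
  (w.isCadlag_xi j).add (IsCadlag.sum _ fun k => (hI k).isCadlag.const_mul _)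

variable {N} in
theorem isCadlag_rhsOf {w : InputPath J K} {I : Fin K → ℝ≥0 → ℝ} (hI : ∀ k, Continuous (I k)) :
    IsCadlag (N.rhsOf w I) :=
  IsCadlag.pi fun k => ((w.isCadlag_zeta k).sub ((hI k).isCadlag.const_mul _)).sub
    (IsCadlag.sum _ fun j => (isCadlag_netOf hI j).reflPsi.const_mul _)

section Perturbation

variable {N} {w w' : InputPath J K} {I I' : Fin K → ℝ≥0 → ℝ} {ε δ : ℝ} {s s' t t' : ℝ≥0}

/-- The data at time `s'` in the primed system and at time `s` in the other one are close: the
inputs up to `ε`, the primitives up to `δ`. -/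
def Close (w w' : InputPath J K) (I I' : Fin K → ℝ≥0 → ℝ) (ε δ : ℝ) (s s' : ℝ≥0) : Prop :=
  dist (w' s') (w s) ≤ ε ∧ ∀ k, |I' k s' - I k s| ≤ δ

theorem Close.abs_netOf_sub_le (h : Close w w' I I' ε δ s s') (hδ : 0 ≤ δ) (j : Fin J) :
    |N.netOf w' I' j s' - N.netOf w I j s| ≤ N.netLip * (ε + δ) := by
  have hε : 0 ≤ ε := dist_nonneg.trans h.1
  have h1 : |w'.xi j s' - w.xi j s| ≤ ε := (dist_le_pi_dist _ _ (Sum.inl j)).trans h.1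
  have h2 : ∀ k, |N.q k j * N.η k * (I' k s' - I k s)| ≤ N.η k * δ := fun k => by
    rw [abs_mul, abs_of_nonneg (mul_nonneg (N.q_nonneg k j) (N.η_pos k).le)]
    exact mul_le_mul (mul_le_of_le_one_left (N.η_pos k).le (N.q_le_one k j)) (h.2 k)
      (abs_nonneg _) (N.η_pos k).le
  have h3 : N.netOf w' I' j s' - N.netOf w I j s =
      (w'.xi j s' - w.xi j s) + ∑ k, N.q k j * N.η k * (I' k s' - I k s) := by
    simp only [netOf, mul_sub, Finset.sum_sub_distrib]
    ring
  rw [h3]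
  calc _ ≤ ε + ∑ k, N.η k * δ := (abs_add_le _ _).trans
        (add_le_add h1 ((Finset.abs_sum_le_sum_abs _ _).trans (Finset.sum_le_sum fun k _ => h2 k)))
    _ = ε + (N.netLip - 1) * δ := by rw [← Finset.sum_mul, netLip, add_sub_cancel_left]
    _ ≤ N.netLip * (ε + δ) := by nlinarith [N.one_le_netLip]

/-- The hypotheses `h`, `h'` match the times of `[0,t]` with those of `[0,t']` in both directions;
they hold for equal times as well as for times related by a time change. -/
theorem abs_reflPsi_netOf_sub_le (hδ : 0 ≤ δ) (hI : ∀ k, Continuous (I k))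
    (hI' : ∀ k, Continuous (I' k)) (h : ∀ s ≤ t, ∃ s' ≤ t', Close w w' I I' ε δ s s')
    (h' : ∀ s' ≤ t', ∃ s ≤ t, Close w w' I I' ε δ s s') (j : Fin J) :
    |reflPsi (N.netOf w' I' j) t' - reflPsi (N.netOf w I j) t| ≤ N.netLip * (ε + δ) := by
  have hε : 0 ≤ ε := let ⟨_, _, hs⟩ := h t le_rfl; dist_nonneg.trans hs.1
  have h0 : 0 ≤ N.netLip * (ε + δ) := by have := N.one_le_netLip; positivity
  rw [abs_le]
  constructor
  · have := reflPsi_le_add h0 ((isCadlag_netOf hI' j).exists_neg_le t')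
      (z := N.netOf w I j) (t := t) fun s hs => by
        obtain ⟨s', hs', hc⟩ := h s hs
        have := (abs_le.1 (hc.abs_netOf_sub_le (N := N) hδ j)).2
        exact ⟨s', hs', by linarith⟩
    linarith
  · have := reflPsi_le_add h0 ((isCadlag_netOf hI j).exists_neg_le t)
      (z := N.netOf w' I' j) (t := t') fun s' hs' => by
        obtain ⟨s, hs, hc⟩ := h' s' hs'
        have := (abs_le.1 (hc.abs_netOf_sub_le (N := N) hδ j)).1
        exact ⟨s, hs, by linarith⟩
    linarith

theorem dist_rhsOf_le (hδ : 0 ≤ δ) (hI : ∀ k, Continuous (I k))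
    (hI' : ∀ k, Continuous (I' k)) (h : ∀ s ≤ t, ∃ s' ≤ t', Close w w' I I' ε δ s s')
    (h' : ∀ s' ≤ t', ∃ s ≤ t, Close w w' I I' ε δ s s') (htt : Close w w' I I' ε δ t t') :
    dist (N.rhsOf w' I' t') (N.rhsOf w I t) ≤ N.rhsLip * (ε + δ) := by
  have hε : 0 ≤ ε := dist_nonneg.trans htt.1
  refine (dist_pi_le_iff (mul_nonneg N.rhsLip_pos.le (add_nonneg hε hδ))).2 fun k => ?_
  have h1 : |w'.zeta k t' - w.zeta k t| ≤ ε := (dist_le_pi_dist _ _ (Sum.inr k)).trans htt.1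
  have h2 : |N.η k * (I' k t' - I k t)| ≤ (N.netLip - 1) * δ := by
    rw [abs_mul, abs_of_pos (N.η_pos k)]
    exact mul_le_mul (N.η_le_netLip_sub_one k) (htt.2 k) (abs_nonneg _)
      ((N.η_pos k).le.trans (N.η_le_netLip_sub_one k))
  have h3 : |∑ j, N.p j k * (reflPsi (N.netOf w' I' j) t' - reflPsi (N.netOf w I j) t)|
      ≤ J * (N.netLip * (ε + δ)) := by
    refine (Finset.abs_sum_le_sum_abs _ _).trans ?_
    calc _ ≤ ∑ _j : Fin J, N.netLip * (ε + δ) := Finset.sum_le_sum fun j _ => by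
          rw [abs_mul, abs_of_nonneg (N.p_nonneg j k)]
          exact (mul_le_of_le_one_left (abs_nonneg _) (N.p_le_one j k)).trans
            (abs_reflPsi_netOf_sub_le hδ hI hI' h h' j)
      _ = _ := by simp
  have h4 : N.rhsOf w' I' t' k - N.rhsOf w I t k = (w'.zeta k t' - w.zeta k t)
      - N.η k * (I' k t' - I k t)
      - ∑ j, N.p j k * (reflPsi (N.netOf w' I' j) t' - reflPsi (N.netOf w I j) t) := by
    simp only [rhsOf, mul_sub, Finset.sum_sub_distrib]
    ring
  rw [Real.dist_eq, h4, rhsLip]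
  rw [abs_le] at *
  constructor <;> nlinarith [N.one_le_netLip]

end Perturbation

/-! ### Picard iteration for the fixed point equation -/

section Picard

variable {N} {w : InputPath J K} {y y' : ℝ≥0 → Fin K → ℝ}

variable (N) in
/-- The fixed point equation for `y` is `N.picard w y = y`. -/
def picard (w : InputPath J K) (y : ℝ≥0 → Fin K → ℝ) : ℝ≥0 → Fin K → ℝ :=
  N.rhsOf w fun k => prim fun s => y s k

theorem isCadlag_picard (hy : IsLocBdd y) : IsCadlag (N.picard w y) :=
  isCadlag_rhsOf fun k => (hy.apply k).continuous_prim

theorem norm_picard_sub_le (hy : IsLocBdd y) (hy' : IsLocBdd y') (t : ℝ≥0) :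
    ‖N.picard w y t - N.picard w y' t‖ ≤ N.rhsLip * prim (fun s => ‖y s - y' s‖) t := by
  have hn : ∀ s, 0 ≤ ‖y s - y' s‖ := fun s => norm_nonneg _
  have h : ∀ s ≤ t, Close w w (fun k => prim fun s => y' s k) (fun k => prim fun s => y s k) 0
      (prim (fun s => ‖y s - y' s‖) t) s s := fun s hs => ⟨by simp, fun k =>
    (abs_prim_apply_sub_le hy hy' s k).trans (prim_mono (hy.sub hy').norm hn hs)⟩
  have := dist_rhsOf_le (N := N) (prim_nonneg hn t) (fun k => (hy'.apply k).continuous_prim)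
    (fun k => (hy.apply k).continuous_prim) (fun s hs => ⟨s, hs, h s hs⟩)
    (fun s hs => ⟨s, hs, h s hs⟩) (h t le_rfl)
  rwa [dist_eq_norm, zero_add] at this

theorem eq_of_picard_eq (hy : IsLocBdd y) (hy' : IsLocBdd y') (h : N.picard w y = y)
    (h' : N.picard w y' = y') : y = y' := by
  have hle : ∀ t, ‖y t - y' t‖ ≤ N.rhsLip * prim (fun s => ‖y s - y' s‖) t := fun t => by
    have := norm_picard_sub_le (N := N) (w := w) hy hy' t
    rwa [h, h'] at this
  funext t
  have hD := prim_le_of_le_add_mul_prim (hy.sub hy').norm (fun s => norm_nonneg _)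
    (continuous_const (y := (0 : ℝ))).isCadlag.isLocBdd (fun _ => le_rfl) N.rhsLip_pos (T := t)
    fun s _ => by simpa using hle s
  rw [prim_const, mul_zero, zero_mul] at hD
  have := (hle t).trans (mul_nonpos_of_nonneg_of_nonpos N.rhsLip_pos.le hD)
  exact sub_eq_zero.1 (norm_le_zero_iff.1 this)

theorem prim_exp {a : ℝ} (ha : a ≠ 0) (t : ℝ≥0) :
    prim (fun s => Real.exp (a * s)) t = (Real.exp (a * t) - 1) / a := by
  have h1 : prim (fun s => Real.exp (a * s)) t = ∫ s in (0 : ℝ)..t, Real.exp (a * s) := by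
    refine intervalIntegral.integral_congr fun s hs => ?_
    rw [uIcc_of_le t.coe_nonneg] at hs
    simp [hs.1]
  have h2 : ∀ s ∈ uIcc (0 : ℝ) t,
      HasDerivAt (fun s => Real.exp (a * s) / a) (Real.exp (a * s)) s := fun s _ => by
    have := ((hasDerivAt_id s).const_mul a).exp.div_const a
    simpa [mul_div_assoc, ha] using this
  rw [h1, intervalIntegral.integral_eq_sub_of_hasDerivAt h2
    (Continuous.intervalIntegrable (by fun_prop) _ _)]
  simp
  ring

/-- Picard iteration. In the weighted norm `sup_{t ≤ T} e^{-2Ct} ‖y(t)‖`, with `C` the Lipschitz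
constant, the iteration contracts by the factor `1/2`. -/
theorem exists_picard_eq (N : NetworkParams J K) (w : InputPath J K) :
    ∃ y, IsLocBdd y ∧ N.picard w y = y := by
  set C := N.rhsLip
  have hC : 0 < C := N.rhsLip_pos
  let Y : ℕ → ℝ≥0 → Fin K → ℝ := fun n => (N.picard w)^[n] fun _ => 0
  have hYs : ∀ n, Y (n + 1) = N.picard w (Y n) := fun n => Function.iterate_succ_apply' _ _ _
  have hY : ∀ n, IsLocBdd (Y n) := by
    intro n
    induction n with
    | zero => exact (continuous_const (y := (0 : Fin K → ℝ))).isCadlag.isLocBdd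
    | succ n ih => rw [hYs]; exact (isCadlag_picard ih).isLocBdd
  have hexp : ∀ c : ℝ, IsLocBdd fun s : ℝ≥0 => c * Real.exp (2 * C * s) := fun c =>
    (show Continuous fun s : ℝ≥0 => c * Real.exp (2 * C * s) by fun_prop).isCadlag.isLocBdd
  have hstep : ∀ T : ℝ≥0, ∃ M, 0 ≤ M ∧ ∀ n, ∀ t ≤ T,
      ‖Y n t - Y (n + 1) t‖ ≤ M / 2 ^ n * Real.exp (2 * C * t) := by
    intro T
    obtain ⟨M, hM0, hM⟩ := (hY 1).2 T
    refine ⟨M, hM0, fun n => ?_⟩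
    induction n with
    | zero =>
      intro t ht
      have h1 : Y 0 t = 0 := rfl
      rw [h1, zero_sub, norm_neg, zero_add, pow_zero, div_one]
      exact (hM t ht).trans (le_mul_of_one_le_right hM0 (Real.one_le_exp (by positivity)))
    | succ n ih =>
      intro t ht
      calc ‖Y (n + 1) t - Y (n + 1 + 1) t‖ = ‖N.picard w (Y n) t - N.picard w (Y (n + 1)) t‖ := by
            rw [← hYs, ← hYs]
        _ ≤ C * prim (fun s => ‖Y n s - Y (n + 1) s‖) t := norm_picard_sub_le (hY _) (hY _) t
        _ ≤ C * prim (fun s => M / 2 ^ n * Real.exp (2 * C * s)) t := by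
            gcongr
            exact prim_le_prim ((hY _).sub (hY _)).norm (hexp _) fun s hs => ih s (hs.trans ht)
        _ = M / 2 ^ (n + 1) * (Real.exp (2 * C * t) - 1) := by
            rw [prim_const_mul, prim_exp (by positivity), pow_succ]
            field_simp
        _ ≤ _ := by gcongr; linarith
  have hgeom : ∀ T : ℝ≥0, ∃ B, 0 ≤ B ∧ ∀ t ≤ T, ∀ n,
      dist (Y n t) (Y (n + 1) t) ≤ B / 2 / 2 ^ n := by
    intro T
    obtain ⟨M, hM0, hM⟩ := hstep T
    refine ⟨2 * (M * Real.exp (2 * C * T)), by positivity, fun t ht n => ?_⟩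
    rw [dist_eq_norm]
    refine (hM n t ht).trans ?_
    have : Real.exp (2 * C * t) ≤ Real.exp (2 * C * T) := by gcongr
    calc M / 2 ^ n * Real.exp (2 * C * t) ≤ M / 2 ^ n * Real.exp (2 * C * T) := by gcongr
      _ = _ := by ring
  have hlim : ∀ t, ∃ l, Tendsto (fun n => Y n t) atTop (𝓝 l) := fun t =>
    let ⟨_, _, hB⟩ := hgeom t
    cauchySeq_tendsto_of_complete (cauchySeq_of_le_geometric_two (hB t le_rfl))
  choose y hy using hlim
  have hdist : ∀ T : ℝ≥0, ∃ B, 0 ≤ B ∧ ∀ t ≤ T, ∀ n, ‖Y n t - y t‖ ≤ B / 2 ^ n := fun T =>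
    let ⟨B, hB0, hB⟩ := hgeom T
    ⟨B, hB0, fun t ht n => by
      rw [← dist_eq_norm]
      exact dist_le_of_le_geometric_two_of_tendsto (hB t ht) (hy t) n⟩
  have hyl : IsLocBdd y := by
    refine ⟨measurable_of_tendsto_metrizable (fun n => (hY n).1) (tendsto_pi_nhds.2 hy),
      fun T => ?_⟩
    obtain ⟨B, hB0, hB⟩ := hdist T
    refine ⟨B, hB0, fun t ht => ?_⟩
    have := hB t ht 0
    have h1 : Y 0 t = 0 := rfl
    simpa [h1] using this
  refine ⟨y, hyl, funext fun t => ?_⟩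
  obtain ⟨B, hB0, hB⟩ := hdist t
  refine tendsto_nhds_unique ?_ ((hy t).comp (tendsto_add_atTop_nat 1))
  rw [tendsto_iff_norm_sub_tendsto_zero]
  have hz : Tendsto (fun n : ℕ => C * (t * (B / 2 ^ n))) atTop (𝓝 0) := by
    have := tendsto_pow_atTop_nhds_zero_of_lt_one (r := (1 / 2 : ℝ)) (by norm_num) (by norm_num)
    simpa [div_eq_mul_inv] using ((this.const_mul B).const_mul (t : ℝ)).const_mul C
  refine squeeze_zero (fun _ => norm_nonneg _) (fun n => ?_) hz
  simp only [Function.comp_apply, hYs]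
  refine (norm_picard_sub_le (hY n) hyl t).trans ?_
  gcongr
  rw [← prim_const]
  exact prim_le_prim ((hY n).sub hyl).norm continuous_const.isCadlag.isLocBdd
    fun s hs => hB s hs n

end Picard

end NetworkParams

/-! ### The regulator map and the complementarity system -/

namespace NetworkParams

variable {J K : ℕ} {N : NetworkParams J K} {w w' : InputPath J K} {v v' : OutputPath J K}

/-- The component `y` of an output path, as a path of vectors. -/
def _root_.OutputPath.yVec (v : OutputPath J K) (t : ℝ≥0) (k : Fin K) : ℝ := v.y k t

theorem _root_.OutputPath.isCadlag_yVec (v : OutputPath J K) : IsCadlag v.yVec :=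
  IsCadlag.pi fun k => v.isCadlag.apply (Sum.inr (Sum.inr k))

theorem _root_.OutputPath.continuous_prim_y (v : OutputPath J K) (k : Fin K) :
    Continuous (prim (v.y k)) :=
  (v.isCadlag_yVec.isLocBdd.apply k).continuous_prim

theorem netInput_eq_netOf (j : Fin J) :
    N.netInput w v j = N.netOf w (fun k => prim (v.y k)) j := rfl

theorem isCadlag_netInput (j : Fin J) : IsCadlag (N.netInput w v j) :=
  isCadlag_netOf v.continuous_prim_y j

theorem IsRegulated.yVec_eq (h : N.IsRegulated w v) :
    v.yVec = N.rhsOf w fun k => prim (v.y k) :=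
  funext fun t => funext fun k => h.y_eq k t

theorem IsRegulated.unique (h : N.IsRegulated w v) (h' : N.IsRegulated w v') : v = v' := by
  have hy : v.yVec = v'.yVec :=
    eq_of_picard_eq (N := N) (w := w) v.isCadlag_yVec.isLocBdd v'.isCadlag_yVec.isLocBdd
      h.yVec_eq.symm h'.yVec_eq.symm
  have hy' : ∀ k, v.y k = v'.y k := fun k => funext fun t => congrFun (congrFun hy t) k
  have hz : ∀ j, N.netInput w v j = N.netInput w v' j := fun j => by
    simp only [netInput_eq_netOf, hy']
  ext t i
  rcases i with j | j | k
  · exact (h.x_eq j t).trans ((hz j).symm ▸ h'.x_eq j t).symm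
  · exact (h.u_eq j t).trans ((hz j).symm ▸ h'.u_eq j t).symm
  · exact congrFun (hy' k) t

theorem exists_isRegulated (N : NetworkParams J K) (w : InputPath J K) :
    ∃ v, N.IsRegulated w v := by
  obtain ⟨y, hy, hfix⟩ := exists_picard_eq N w
  set z := N.netOf w fun k => prim fun s => y s k
  have hz : ∀ j, IsCadlag (z j) := isCadlag_netOf fun k => (hy.apply k).continuous_prim
  have hyc : IsCadlag y := hfix ▸ isCadlag_picard hy
  have hv : IsCadlag fun t => (Sum.elim (fun j => reflPhi (z j) t)
      (Sum.elim (fun j => (N.μ j)⁻¹ * reflPsi (z j) t) (y t)) : Fin J ⊕ Fin J ⊕ Fin K → ℝ) := by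
    refine IsCadlag.pi fun i => ?_
    rcases i with j | j | k
    · exact (hz j).add (hz j).reflPsi
    · exact (hz j).reflPsi.const_mul _
    · exact hyc.apply k
  exact ⟨⟨_, hv.1, hv.2⟩, fun _ _ => rfl, fun _ _ => rfl,
    fun k t => (congrFun (congrFun hfix t) k).symm⟩

theorem isRegulated_regulatorMap (N : NetworkParams J K) (w : InputPath J K) :
    N.IsRegulated w (N.regulatorMap w) :=
  Classical.epsilon_spec (exists_isRegulated N w)

theorem regulatorMap_eq_iff : N.regulatorMap w = v ↔ N.IsRegulated w v :=
  ⟨fun h => h ▸ isRegulated_regulatorMap N w, (isRegulated_regulatorMap N w).unique⟩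

theorem IsRegulated.μ_mul_u (h : N.IsRegulated w v) (j : Fin J) (t : ℝ≥0) :
    N.μ j * v.u j t = reflPsi (N.netInput w v j) t := by
  rw [h.u_eq, mul_inv_cancel_left₀ (N.μ_pos j).ne']

theorem IsRegulated.x_eq_add (h : N.IsRegulated w v) (j : Fin J) (t : ℝ≥0) :
    v.x j t = N.netInput w v j t + reflPsi (N.netInput w v j) t := h.x_eq j t

theorem IsRegulated.monotone_u (h : N.IsRegulated w v) (j : Fin J) : Monotone (v.u j) :=
  fun s t hst => by
    rw [h.u_eq, h.u_eq]
    exact mul_le_mul_of_nonneg_left ((isCadlag_netInput j).reflPsi_mono hst)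
      (inv_nonneg.2 (N.μ_pos j).le)

/-- Mass is conserved because the rows of the routing matrices sum to `1`. -/
theorem IsRegulated.sum_eq (h : N.IsRegulated w v) (t : ℝ≥0) :
    ∑ j, v.x j t + ∑ k, v.y k t = ∑ j, w.xi j t + ∑ k, w.zeta k t := by
  have hx : ∑ j, v.x j t = ∑ j, w.xi j t + ∑ k, N.η k * prim (v.y k) t
      + ∑ j, reflPsi (N.netInput w v j) t := by
    have : ∑ j, ∑ k, N.q k j * N.η k * prim (v.y k) t = ∑ k, N.η k * prim (v.y k) t := by
      rw [Finset.sum_comm]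
      refine Finset.sum_congr rfl fun k _ => ?_
      rw [← Finset.sum_mul, ← Finset.sum_mul, N.q_sum, one_mul]
    rw [← this, ← Finset.sum_add_distrib, ← Finset.sum_add_distrib]
    exact Finset.sum_congr rfl fun j _ => h.x_eq j t
  have hy : ∑ k, v.y k t = ∑ k, w.zeta k t - ∑ k, N.η k * prim (v.y k) t
      - ∑ j, reflPsi (N.netInput w v j) t := by
    have : ∑ k, ∑ j, N.p j k * reflPsi (N.netInput w v j) t
        = ∑ j, reflPsi (N.netInput w v j) t := by
      rw [Finset.sum_comm]
      refine Finset.sum_congr rfl fun j _ => ?_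
      rw [← Finset.sum_mul, N.p_sum, one_mul]
    rw [← this, ← Finset.sum_sub_distrib, ← Finset.sum_sub_distrib]
    exact Finset.sum_congr rfl fun k _ => h.y_eq k t
  rw [hx, hy]
  ring

theorem netInput_zero (j : Fin J) : N.netInput w v j 0 = w.xi j 0 := by
  simp [netInput]

theorem IsRegulated.solvesSystem (hw : w.Admissible) (h : N.IsRegulated w v) :
    N.SolvesSystem w v where
  x_eq j t := by rw [h.μ_mul_u]; exact h.x_eq j t
  x_nonneg j t := by
    have := neg_le_reflPsi ((isCadlag_netInput (N := N) (w := w) (v := v) j).exists_neg_le t) le_rfl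
    rw [h.x_eq_add]
    linarith
  y_eq k t := by
    simp only [mul_assoc, h.μ_mul_u]
    exact h.y_eq k t
  sum_eq t := (h.sum_eq t).trans (hw.1 t)
  u_zero j := by
    have : reflPsi (N.netInput w v j) 0 ≤ 0 := reflPsi_le le_rfl fun s hs => by
      rw [nonpos_iff_eq_zero.1 hs, netInput_zero]
      exact neg_nonpos.2 (hw.2 j)
    rw [h.u_eq, le_antisymm this (reflPsi_nonneg _ _), mul_zero]
  u_mono := h.monotone_u
  complementarity j := by
    simp only [h.x_eq_add]
    exact measure_reflected_pos_eq_zero _ (N.μ_pos j) (isCadlag_netInput j) (h.μ_mul_u j)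

/-- The complementarity condition identifies `μ_j u_j` with `ψ(z_j)`, by uniqueness in the Skorokhod
problem. -/
theorem SolvesSystem.isRegulated (h : N.SolvesSystem w v) : N.IsRegulated w v := by
  have hx : ∀ j t, v.x j t = N.netInput w v j t + N.μ j * v.u j t := h.x_eq
  have hψ : ∀ j t, N.μ j * v.u j t = reflPsi (N.netInput w v j) t := fun j =>
    eq_reflPsi_of_complementarity (v.uStieltjes j (h.u_mono j)) (N.μ_pos j) (h.u_zero j)
      (fun t => hx j t ▸ h.x_nonneg j t) (by
        have := h.complementarity j
        simp only [hx] at this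
        exact this)
  refine ⟨fun j t => ?_, fun j t => ?_, fun k t => ?_⟩
  · rw [hx, hψ, reflPhi]
  · rw [← hψ, inv_mul_cancel_left₀ (N.μ_pos j).ne']
  · rw [h.y_eq]
    simp only [mul_assoc, hψ]

/-- An output path can only be continuous where the data are, since the data are recovered from it
by continuous operations. -/
theorem IsRegulated.continuousAt_input (h : N.IsRegulated w v) {t : ℝ≥0}
    (hv : ContinuousAt v t) : ContinuousAt w t := by
  have hx : ∀ j, ContinuousAt (v.x j) t := fun j => (continuousAt_pi.1 hv) (Sum.inl j)
  have hu : ∀ j, ContinuousAt (v.u j) t := fun j => (continuousAt_pi.1 hv) (Sum.inr (Sum.inl j))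
  have hy : ∀ k, ContinuousAt (v.y k) t := fun k => (continuousAt_pi.1 hv) (Sum.inr (Sum.inr k))
  have hI : ∀ k, ContinuousAt (prim (v.y k)) t := fun k => (v.continuous_prim_y k).continuousAt
  refine continuousAt_pi.2 fun i => ?_
  rcases i with j | k
  · have hxi : (fun s => w s (Sum.inl j)) = fun s =>
        v.x j s - N.μ j * v.u j s - ∑ k, N.q k j * N.η k * prim (v.y k) s := by
      funext s
      rw [h.μ_mul_u, h.x_eq_add]
      show w.xi j s = w.xi j s + ∑ k, N.q k j * N.η k * prim (v.y k) s + _ - _ - _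
      ring
    rw [hxi]
    exact ((hx j).sub (continuousAt_const.mul (hu j))).sub
      (tendsto_finsetSum _ fun k _ => continuousAt_const.mul (hI k))
  · have hζ : (fun s => w s (Sum.inr k)) = fun s =>
        v.y k s + N.η k * prim (v.y k) s + ∑ j, N.p j k * (N.μ j * v.u j s) := by
      funext s
      simp only [h.μ_mul_u]
      rw [h.y_eq]
      show w.zeta k s = w.zeta k s - N.η k * prim (v.y k) s - _ + _ + _
      ring
    rw [hζ]
    exact ((hy k).add (continuousAt_const.mul (hI k))).add
      (tendsto_finsetSum _ fun j _ => continuousAt_const.mul (continuousAt_const.mul (hu j)))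

end NetworkParams

/-! ### Continuity for the `J₁` topology -/

namespace NetworkParams

variable {J K : ℕ} {N : NetworkParams J K} {w w' : InputPath J K} {v v' : OutputPath J K}

/-- The inverse of a time change of `[0,T]`, extended to `[0,∞)` by its value at `T`. -/
def _root_.TimeChange.inv {T : ℝ≥0} (l : TimeChange T) (s : ℝ≥0) : ℝ≥0 :=
  l.1.symm (projIcc 0 T zero_le s)

theorem _root_.TimeChange.continuous_inv {T : ℝ≥0} (l : TimeChange T) : Continuous l.inv :=
  continuous_subtype_val.comp (l.1.symm.continuous.comp continuous_projIcc)

theorem _root_.TimeChange.inv_le {T : ℝ≥0} (l : TimeChange T) (s : ℝ≥0) : l.inv s ≤ T :=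
  (l.1.symm (projIcc 0 T zero_le s)).2.2

theorem _root_.TimeChange.exists_inv {T : ℝ≥0} (l : TimeChange T) {s : ℝ≥0} (hs : s ≤ T) :
    ∃ t : Icc (0 : ℝ≥0) T, l.inv s = t ∧ (l.1 t : ℝ≥0) = s :=
  ⟨l.1.symm ⟨s, zero_le, hs⟩, by
    rw [TimeChange.inv, projIcc_of_mem zero_le ⟨zero_le, hs⟩], by rw [l.1.apply_symm_apply]⟩

section Estimate

variable {T : ℝ≥0} {l : TimeChange T} {ε M : ℝ}

/-- The accumulated distance `∫_0^t ‖y'(s) - y(s)‖ ds` of the components `y` of two outputs. -/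
def gap (v v' : OutputPath J K) : ℝ≥0 → ℝ := prim fun s => ‖v'.yVec s - v.yVec s‖

theorem isLocBdd_norm_yVec_sub : IsLocBdd fun s => ‖v'.yVec s - v.yVec s‖ :=
  (v'.isCadlag_yVec.isLocBdd.sub v.isCadlag_yVec.isLocBdd).norm

theorem gap_mono : Monotone (gap v v') :=
  prim_mono isLocBdd_norm_yVec_sub fun _ => norm_nonneg _

theorem gap_nonneg (t : ℝ≥0) : 0 ≤ gap v v' t := prim_nonneg (fun _ => norm_nonneg _) t

/-- The time change enters the difference of the primitives only through the Lipschitz continuity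
of the fixed primitive `∫ y`, so that no bound on `y'` and no derivative of the time change is
needed. -/
theorem close_timeChange (hw : ∀ t, dist (w' (l.1 t)) (w t) ≤ ε)
    (hl : ∀ t, dist (l.1 t : ℝ≥0) t ≤ ε) (hM0 : 0 ≤ M) (hM : ∀ t ≤ T, ‖v.yVec t‖ ≤ M)
    {s t : Icc (0 : ℝ≥0) T} (hst : s ≤ t) :
    Close w w' (fun k => prim (v.y k)) (fun k => prim (v'.y k)) ε (M * ε + gap v v' (l.1 t))
      s (l.1 s) := by
  refine ⟨hw s, fun k => ?_⟩
  have h1 := abs_prim_apply_sub_le v'.isCadlag_yVec.isLocBdd v.isCadlag_yVec.isLocBdd (l.1 s) k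
  have h2 : gap v v' (l.1 s) ≤ gap v v' (l.1 t) := gap_mono (l.2.monotone hst)
  have h3 := abs_prim_sub_le (v.isCadlag_yVec.isLocBdd.apply k)
    (fun t ht => (norm_le_pi_norm _ k).trans (hM t ht)) s.2.2 (l.1 s).2.2
  have h4 := mul_le_mul_of_nonneg_left (hl s) hM0
  calc _ ≤ |prim (v'.y k) (l.1 s) - prim (v.y k) (l.1 s)|
        + |prim (v.y k) (l.1 s) - prim (v.y k) s| := abs_sub_le _ _ _
    _ ≤ gap v v' (l.1 s) + M * dist (l.1 s : ℝ≥0) s := add_le_add h1 h3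
    _ ≤ _ := by linarith

theorem close_timeChange_of_le (hw : ∀ t, dist (w' (l.1 t)) (w t) ≤ ε)
    (hl : ∀ t, dist (l.1 t : ℝ≥0) t ≤ ε) (hM0 : 0 ≤ M) (hM : ∀ t ≤ T, ‖v.yVec t‖ ≤ M)
    (t : Icc (0 : ℝ≥0) T) :
    (∀ s ≤ (t : ℝ≥0), ∃ s' ≤ (l.1 t : ℝ≥0), Close w w' (fun k => prim (v.y k))
      (fun k => prim (v'.y k)) ε (M * ε + gap v v' (l.1 t)) s s') ∧
    ∀ s' ≤ (l.1 t : ℝ≥0), ∃ s ≤ (t : ℝ≥0), Close w w' (fun k => prim (v.y k))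
      (fun k => prim (v'.y k)) ε (M * ε + gap v v' (l.1 t)) s s' := by
  constructor
  · intro s hs
    have hst : (⟨s, zero_le, hs.trans t.2.2⟩ : Icc (0 : ℝ≥0) T) ≤ t := hs
    exact ⟨_, l.2.monotone hst, close_timeChange hw hl hM0 hM hst⟩
  · intro s' hs'
    obtain ⟨s, -, hs⟩ := l.exists_inv (hs'.trans (l.1 t).2.2)
    have hst : s ≤ t := l.2.le_iff_le.1 (hs.trans_le hs')
    exact ⟨s, hst, hs ▸ close_timeChange hw hl hM0 hM hst⟩

/-- The bound involves `gap` only up to the time `λ(t)` at which `y'` is evaluated, so that it reads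
as an integral inequality in the variable `s = λ(t)`. -/
theorem IsRegulated.dist_yVec_le (hv : N.IsRegulated w v) (hv' : N.IsRegulated w' v')
    (hw : ∀ t, dist (w' (l.1 t)) (w t) ≤ ε) (hl : ∀ t, dist (l.1 t : ℝ≥0) t ≤ ε) (hM0 : 0 ≤ M)
    (hM : ∀ t ≤ T, ‖v.yVec t‖ ≤ M) (t : Icc (0 : ℝ≥0) T) :
    dist (v'.yVec (l.1 t)) (v.yVec t) ≤ N.rhsLip * (ε + (M * ε + gap v v' (l.1 t))) := by
  have hε : 0 ≤ ε := dist_nonneg.trans (hl t)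
  obtain ⟨h1, h2⟩ := close_timeChange_of_le (v' := v') hw hl hM0 hM t
  rw [hv.yVec_eq, hv'.yVec_eq]
  exact dist_rhsOf_le (add_nonneg (mul_nonneg hM0 hε) (gap_nonneg _)) v.continuous_prim_y
    v'.continuous_prim_y h1 h2 (close_timeChange hw hl hM0 hM le_rfl)

variable (N) in
/-- A Lipschitz constant of the output in terms of the inputs and the primitives. -/
def outLip : ℝ := 2 * N.rhsLip * (1 + ∑ j, (N.μ j)⁻¹)

theorem IsRegulated.dist_le (hv : N.IsRegulated w v) (hv' : N.IsRegulated w' v')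
    (hw : ∀ t, dist (w' (l.1 t)) (w t) ≤ ε) (hl : ∀ t, dist (l.1 t : ℝ≥0) t ≤ ε) (hM0 : 0 ≤ M)
    (hM : ∀ t ≤ T, ‖v.yVec t‖ ≤ M) (t : Icc (0 : ℝ≥0) T) :
    dist (v' (l.1 t)) (v t) ≤ N.outLip * (ε + (M * ε + gap v v' T)) := by
  have hε : 0 ≤ ε := dist_nonneg.trans (hl t)
  set δ := M * ε + gap v v' (l.1 t) with hδdef
  have hδ : 0 ≤ δ := add_nonneg (mul_nonneg hM0 hε) (gap_nonneg _)
  have hδT : δ ≤ M * ε + gap v v' T := add_le_add_right (gap_mono (l.1 t).2.2) _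
  have hS : ∀ j, 0 ≤ (N.μ j)⁻¹ := fun j => inv_nonneg.2 (N.μ_pos j).le
  have hS0 : 0 ≤ ∑ j, (N.μ j)⁻¹ := Finset.sum_nonneg fun j _ => hS j
  have hC := N.rhsLip_pos
  have hAC := N.netLip_le_rhsLip
  have hCO : 2 * N.rhsLip ≤ N.outLip :=
    le_mul_of_one_le_right (by positivity) (le_add_of_nonneg_right hS0)
  suffices h : dist (v' (l.1 t)) (v t) ≤ N.outLip * (ε + δ) by
    refine h.trans ?_
    have : 0 ≤ N.outLip := le_trans (by positivity) hCO
    gcongr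
  obtain ⟨h1, h2⟩ := close_timeChange_of_le (v' := v') hw hl hM0 hM t
  have hψ : ∀ j, |reflPsi (N.netInput w' v' j) (l.1 t) - reflPsi (N.netInput w v j) t|
      ≤ N.netLip * (ε + δ) :=
    abs_reflPsi_netOf_sub_le hδ v.continuous_prim_y v'.continuous_prim_y h1 h2
  have hεδ : 0 ≤ ε + δ := add_nonneg hε hδ
  refine (dist_pi_le_iff (mul_nonneg (le_trans (by positivity) hCO) hεδ)).2 fun i => ?_
  rcases i with j | j | k
  · have hz : |N.netInput w' v' j (l.1 t) - N.netInput w v j t| ≤ N.netLip * (ε + δ) :=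
      (close_timeChange hw hl hM0 hM le_rfl).abs_netOf_sub_le hδ j
    show |v'.x j (l.1 t) - v.x j t| ≤ _
    rw [hv.x_eq_add, hv'.x_eq_add, add_sub_add_comm]
    calc _ ≤ N.netLip * (ε + δ) + N.netLip * (ε + δ) :=
          (abs_add_le _ _).trans (add_le_add hz (hψ j))
      _ = 2 * N.netLip * (ε + δ) := by ring
      _ ≤ _ := by gcongr; linarith
  · show |v'.u j (l.1 t) - v.u j t| ≤ _
    rw [hv.u_eq, hv'.u_eq, ← mul_sub, abs_mul, abs_of_nonneg (hS j)]
    calc _ ≤ (∑ j, (N.μ j)⁻¹) * (N.netLip * (ε + δ)) :=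
          mul_le_mul (Finset.single_le_sum (fun j _ => hS j) (Finset.mem_univ j)) (hψ j)
            (abs_nonneg _) hS0
      _ ≤ (∑ j, (N.μ j)⁻¹) * (2 * N.rhsLip * (ε + δ)) := by gcongr; linarith
      _ ≤ (1 + ∑ j, (N.μ j)⁻¹) * (2 * N.rhsLip * (ε + δ)) := by gcongr; linarith
      _ = _ := by rw [outLip]; ring
  · have hy := (dist_le_pi_dist (v'.yVec (l.1 t)) (v.yVec t) k).trans
      (hv.dist_yVec_le hv' hw hl hM0 hM t)
    refine hy.trans ?_
    rw [← hδdef]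
    gcongr
    linarith

/-- The distance `‖y(λ⁻¹(s)) - y(s)‖` between a path and its time change. -/
def shift (v : OutputPath J K) (l : TimeChange T) (s : ℝ≥0) : ℝ := ‖v.yVec (l.inv s) - v.yVec s‖

theorem isLocBdd_shift (v : OutputPath J K) (l : TimeChange T) : IsLocBdd (shift v l) := by
  refine IsLocBdd.norm (IsLocBdd.sub ⟨?_, fun _ => ?_⟩ v.isCadlag_yVec.isLocBdd)
  · exact v.isCadlag_yVec.measurable.comp l.continuous_inv.measurable
  · obtain ⟨M, h0, hM⟩ := v.isCadlag_yVec.exists_bound T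
    exact ⟨M, h0, fun t _ => hM _ (l.inv_le t)⟩

/-- Grönwall's inequality in the original time scale: the time change has been moved from `y'` to
the fixed path `y`. -/
theorem IsRegulated.gap_le (hv : N.IsRegulated w v) (hv' : N.IsRegulated w' v')
    (hw : ∀ t, dist (w' (l.1 t)) (w t) ≤ ε) (hl : ∀ t, dist (l.1 t : ℝ≥0) t ≤ ε) (hM0 : 0 ≤ M)
    (hM : ∀ t ≤ T, ‖v.yVec t‖ ≤ M) :
    gap v v' T ≤ (T * (N.rhsLip * (ε + M * ε)) + prim (shift v l) T) * Real.exp (N.rhsLip * T) := by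
  have hε : 0 ≤ ε := dist_nonneg.trans (hl ⟨0, by simp⟩)
  have hC := N.rhsLip_pos
  have hc : IsLocBdd fun _ : ℝ≥0 => N.rhsLip * (ε + M * ε) := continuous_const.isCadlag.isLocBdd
  have hb := isLocBdd_shift v l
  rw [← prim_const, ← prim_add hc hb]
  refine prim_le_of_le_add_mul_prim isLocBdd_norm_yVec_sub (fun _ => norm_nonneg _)
    (hc.add hb) (fun s => ?_) hC fun s hs => ?_
  · have : 0 ≤ shift v l s := norm_nonneg _
    exact add_nonneg (mul_nonneg hC.le (add_nonneg hε (mul_nonneg hM0 hε))) this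
  · obtain ⟨t, hst, hts⟩ := l.exists_inv hs
    have h1 := hv.dist_yVec_le hv' hw hl hM0 hM t
    rw [hts, dist_eq_norm] at h1
    have h2 := norm_sub_le_norm_sub_add_norm_sub (v'.yVec s) (v.yVec t) (v.yVec s)
    change _ ≤ N.rhsLip * (ε + M * ε) + ‖v.yVec (l.inv s) - v.yVec s‖ + N.rhsLip * gap v v' s
    rw [hst]
    linarith

end Estimate

/-- Dominated convergence, since a càdlàg path is continuous at almost every time. -/
theorem tendsto_prim_shift {T : ℝ≥0} (v : OutputPath J K) {l : ℕ → TimeChange T} {ε : ℕ → ℝ}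
    (hε : Tendsto ε atTop (𝓝 0)) (hl : ∀ᶠ n in atTop, ∀ t, dist ((l n).1 t : ℝ≥0) t ≤ ε n) :
    Tendsto (fun n => prim (shift v (l n)) T) atTop (𝓝 0) := by
  obtain ⟨M, h0, hM⟩ := v.isCadlag_yVec.exists_bound T
  rw [← intervalIntegral.integral_zero (a := (0 : ℝ)) (b := T) (μ := volume)]
  refine intervalIntegral.tendsto_integral_filter_of_dominated_convergence (fun _ => M + M)
    (.of_forall fun n =>
      ((isLocBdd_shift v (l n)).intervalIntegrable 0 T).def'.aestronglyMeasurable)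
    (.of_forall fun n => .of_forall fun s hs => ?_) (by simp) ?_
  · rw [uIoc_of_le T.coe_nonneg] at hs
    rw [shift, norm_norm]
    exact (norm_sub_le _ _).trans (add_le_add (hM _ ((l n).inv_le _))
      (hM _ (Real.toNNReal_le_iff_le_coe.2 hs.2)))
  · filter_upwards [v.isCadlag_yVec.ae_continuousAt] with s hs hsT
    rw [uIoc_of_le T.coe_nonneg] at hsT
    have hsT' : s.toNNReal ≤ T := Real.toNNReal_le_iff_le_coe.2 hsT.2
    have hinv : Tendsto (fun n => (l n).inv s.toNNReal) atTop (𝓝 s.toNNReal) := by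
      rw [tendsto_iff_dist_tendsto_zero]
      refine squeeze_zero' (.of_forall fun _ => dist_nonneg) (hl.mono fun n hn => ?_) hε
      obtain ⟨t, hst, hts⟩ := (l n).exists_inv hsT'
      rw [hst, dist_comm]
      exact hts ▸ hn t
    exact tendsto_iff_norm_sub_tendsto_zero.1 ((hs hsT.1.le).tendsto.comp hinv)

/-- A time change that attains the infimum up to `r`. -/
theorem exists_timeChange {ι : Type*} [Fintype ι] (T : ℝ≥0) (x y : SkorokhodD ι) {r : ℝ≥0∞}
    (hr : 0 < r) : ∃ l : TimeChange T, max (⨆ t : Icc (0 : ℝ≥0) T, edist (x (l.1 t)) (y t))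
      (⨆ t : Icc (0 : ℝ≥0) T, edist (l.1 t) t) ≤ skorokhodDist T x y + r := by
  by_cases h : skorokhodDist T x y = ⊤
  · exact ⟨⟨Homeomorph.refl _, strictMono_id⟩, by simp [h]⟩
  · obtain ⟨l, hl⟩ := iInf_lt_iff.1 (ENNReal.lt_add_right h hr.ne')
    exact ⟨l, hl.le⟩

/-- Time changes that are nearly optimal for the inputs also serve for the outputs. -/
theorem j1Converges_regulatorMap {wn : ℕ → InputPath J K} (h : J1Converges wn w) :
    J1Converges (fun n => N.regulatorMap (wn n)) (N.regulatorMap w) := by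
  intro T hT hcont
  set v := N.regulatorMap w
  have hv : N.IsRegulated w v := isRegulated_regulatorMap N w
  have hvn : ∀ n, N.IsRegulated (wn n) (N.regulatorMap (wn n)) :=
    fun n => isRegulated_regulatorMap N (wn n)
  have hw := h T hT (hv.continuousAt_input hcont)
  obtain ⟨M, hM0, hM⟩ := v.isCadlag_yVec.exists_bound T
  choose l hl using fun n : ℕ => exists_timeChange T (wn n) w
    (r := (n : ℝ≥0∞)⁻¹) (ENNReal.inv_pos.2 (ENNReal.natCast_ne_top n))
  set e : ℕ → ℝ≥0∞ := fun n => max (⨆ t : Icc (0 : ℝ≥0) T, edist (wn n ((l n).1 t)) (w t))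
      (⨆ t : Icc (0 : ℝ≥0) T, edist ((l n).1 t) t)
  have he : Tendsto e atTop (𝓝 0) := by
    refine tendsto_of_tendsto_of_tendsto_of_le_of_le tendsto_const_nhds ?_ (fun _ => zero_le) hl
    simpa using hw.add ENNReal.tendsto_inv_nat_nhds_zero
  have hfin : ∀ᶠ n in atTop, e n ≠ ⊤ :=
    (he.eventually_lt_const ENNReal.zero_lt_top).mono fun n hn => hn.ne
  have hε : Tendsto (fun n => (e n).toReal) atTop (𝓝 0) :=
    (ENNReal.tendsto_toReal ENNReal.zero_ne_top).comp he
  have hdist : ∀ {X : Type} [PseudoMetricSpace X] (a b : X) (n : ℕ), e n ≠ ⊤ →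
      edist a b ≤ e n → dist a b ≤ (e n).toReal := fun a b n hn hab => by
    rw [dist_edist]
    exact ENNReal.toReal_mono hn hab
  have h1 : ∀ᶠ n in atTop, ∀ t, dist (wn n ((l n).1 t)) (w t) ≤ (e n).toReal :=
    hfin.mono fun n hn t => hdist _ _ n hn (le_max_of_le_left
      (le_iSup (fun t : Icc (0 : ℝ≥0) T => edist (wn n ((l n).1 t)) (w t)) t))
  have h2 : ∀ᶠ n in atTop, ∀ t, dist ((l n).1 t : ℝ≥0) t ≤ (e n).toReal :=
    hfin.mono fun n hn t => hdist _ _ n hn (le_max_of_le_right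
      (le_iSup (fun t : Icc (0 : ℝ≥0) T => edist ((l n).1 t) t) t))
  have hgap : Tendsto (fun n => gap v (N.regulatorMap (wn n)) T) atTop (𝓝 0) := by
    have hb : Tendsto (fun n => (T * (N.rhsLip * ((e n).toReal + M * (e n).toReal))
        + prim (shift v (l n)) T) * Real.exp (N.rhsLip * T)) atTop (𝓝 0) := by
      simpa using ((((hε.add (hε.const_mul M)).const_mul N.rhsLip).const_mul (T : ℝ)).add
        (tendsto_prim_shift v hε h2)).mul_const (Real.exp (N.rhsLip * T))
    refine squeeze_zero' (.of_forall fun n => gap_nonneg T) ?_ hb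
    filter_upwards [h1, h2] with n h1 h2
    exact hv.gap_le (hvn n) h1 h2 hM0 hM
  have hout : Tendsto (fun n => max (ENNReal.ofReal (N.outLip * ((e n).toReal
      + (M * (e n).toReal + gap v (N.regulatorMap (wn n)) T)))) (e n)) atTop (𝓝 0) := by
    have := ENNReal.tendsto_ofReal ((hε.add ((hε.const_mul M).add hgap)).const_mul N.outLip)
    simpa using this.max he
  refine tendsto_of_tendsto_of_tendsto_of_le_of_le' tendsto_const_nhds hout
    (.of_forall fun _ => zero_le) ?_
  filter_upwards [h1, h2] with n h1 h2
  refine (iInf_le _ (l n)).trans (max_le_max (iSup_le fun t => ?_) (le_max_right _ _))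
  rw [edist_dist]
  exact ENNReal.ofReal_le_ofReal (hv.dist_le (hvn n) h1 h2 hM0 hM t)

/-- The topology is determined by its `J₁`-convergent sequences, so sequential continuity
suffices. -/
theorem continuous_regulatorMap (N : NetworkParams J K) : Continuous N.regulatorMap :=
  ⟨fun _ hU w hw _ hwn => hU _ hw _ (j1Converges_regulatorMap hwn)⟩

end NetworkParams

end

/-- The regulator map is well defined on all of `D^{J+K}`, is the solution map of the system on the
admissible data, and is continuous for the Skorokhod `J₁` topologies, both as a map of topological
spaces and along `J₁`-convergent sequences. -/
theorem proposition4p3 {J K : ℕ} (N : NetworkParams J K) :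
    (∀ (w : InputPath J K) (v : OutputPath J K), N.regulatorMap w = v ↔ N.IsRegulated w v) ∧
    (∀ w : InputPath J K, w.Admissible →
      ∀ v : OutputPath J K, N.regulatorMap w = v ↔ N.SolvesSystem w v) ∧
    Continuous N.regulatorMap ∧
    (∀ (wn : ℕ → InputPath J K) (w : InputPath J K), J1Converges wn w →
      J1Converges (fun n => N.regulatorMap (wn n)) (N.regulatorMap w)) :=
  ⟨fun _ _ => NetworkParams.regulatorMap_eq_iff,
    fun _ hw _ => NetworkParams.regulatorMap_eq_iff.trans
      ⟨fun h => h.solvesSystem hw, fun h => h.isRegulated⟩,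
    NetworkParams.continuous_regulatorMap N,
    fun _ _ h => NetworkParams.j1Converges_regulatorMap h⟩
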